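/- For real $\rho>1$ let $$\mathcal{E}_\rho=\left\{\tfrac12\left(u+u^{-1}\right) : u=\rho e^{i\theta},\ 0\le\theta<2\pi\right\}$$ be the Bernstein ellipse, whose minor axis has the endpoints $\pm\tfrac{i}{2}(\rho-\rho^{-1})$. For real $\lambda>0$ and $n\ge 0$ let $$C_n^{\lambda}(x)=\frac{\Gamma(\lambda+\frac12)}{\Gamma(2\lambda)}\,\frac{\Gamma(n+2\lambda)}{\Gamma(n+\lambda+\frac12)}\,P_n^{(\lambda-\frac12,\lambda-\frac12)}(x)$$ be the Gegenbauer polynomial, where $$P_n^{(\alpha,\beta)}(x)=2^{-n}\sum_{k=0}^{n}\binom{n+\alpha}{n-k}\binom{n+\beta}{k}(x-1)^k(x+1)^{n-k},\qquad \alpha,\beta>-1,$$ is the Jacobi polynomial. Put $a_k(\rho)=\tfrac12(\rho^k+\rho^{-k})$. **Theorem.** The number $\rho_2^*=\tfrac12(\sqrt2+\sqrt6)\approx1.932$ is the unique root in $(1,\infty)$ of the equation $a_3(\rho)-3a_1(\rho)=0$. Let $\rho\ge\rho_2^*$ be real and let $n\ge2$ be an integer. If $\lambda>1$, or if $0<\lambda<1$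 and $n$ is odd, then the minimum of $|C_n^\lambda(z)|$ over $z\in\mathcal{E}_\rho$ is attained at both endpoints of the minor axis, that is, $$\min_{z\in\mathcal{E}_\rho}\left|C_n^\lambda(z)\right|=\left|C_n^\lambda\!\left(\tfrac{i}{2}(\rho-\rho^{-1})\right)\right|=\left|C_n^\lambda\!\left(-\tfrac{i}{2}(\rho-\rho^{-1})\right)\right|.$$ -/

import Mathlib

open Polynomial

noncomputable section

/-- The Bernstein ellipse `{(u + u⁻¹) / 2 : u = ρ e^{iθ}, 0 ≤ θ < 2π}` (used for `ρ ≥ 1`),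
with foci `±1`. -/
def bernsteinEllipse (ρ : ℝ) : Set ℂ :=
  {z | ∃ θ : ℝ, 0 ≤ θ ∧ θ < 2 * Real.pi ∧ ∃ u : ℂ,
    u = (ρ : ℂ) * Complex.exp (Complex.I * (θ : ℂ)) ∧ z = (u + u⁻¹) / 2}

/-- The Jacobi polynomial `P_n^{(α,β)}`, with real parameters `α, β > -1`. Here
`Ring.choose a k = a (a - 1) ⋯ (a - k + 1) / k!` is the binomial coefficient with real top. -/
def jacobiPoly (α β : ℝ) (n : ℕ) : ℝ[X] :=
  C (((2 : ℝ) ^ n)⁻¹) * ∑ k ∈ Finset.range (n + 1),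
    C (Ring.choose ((n : ℝ) + α) (n - k) * Ring.choose ((n : ℝ) + β) k) *
      ((X - 1) ^ k * (X + 1) ^ (n - k))

/-- The Gegenbauer (ultraspherical) polynomial `C_n^l`, for a real parameter `l > -1/2`, `l ≠ 0`,
as the usual multiple of the Jacobi polynomial with `α = β = l - 1/2`. -/
def gegenbauerPoly (l : ℝ) (n : ℕ) : ℝ[X] :=
  C (Real.Gamma (l + 1 / 2) / Real.Gamma (2 * l) *
      (Real.Gamma ((n : ℝ) + 2 * l) / Real.Gamma ((n : ℝ) + l + 1 / 2))) *
    jacobiPoly (l - 1 / 2) (l - 1 / 2) n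

/-- `a_k(ρ) = (ρ^k + ρ^{-k}) / 2`. -/
def ellipseA (k : ℕ) (ρ : ℝ) : ℝ := (ρ ^ k + (ρ ^ k)⁻¹) / 2

/-- The number `(√2 + √6) / 2 ≈ 1.932`. -/
def rhoTwoStar : ℝ := (Real.sqrt 2 + Real.sqrt 6) / 2

/-- The endpoint `i (ρ - ρ⁻¹) / 2` of the minor axis of the Bernstein ellipse; the other one is
its negative. -/
def minorAxisEndpoint (ρ : ℝ) : ℂ := Complex.I / 2 * ((ρ : ℂ) - (ρ : ℂ)⁻¹)

end

/-! The engine is a transfer principle. Suppose Q/P = A + Σ mᵢ/(z² - xᵢ²) with real A, mᵢ ≥ 0 and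
real |xᵢ| ≤ 1. For ρ ≥ ρ₂*, each Re 1/(z² - xᵢ²) is least on the ellipse at the ends of the minor
axis, where Q/P is real. If it is also nonnegative there, then |Q/P| ≥ Re(Q/P) ≥ its value at those
ends, so minimality of |P| there passes to Q (`MinAtMinorAxis.of_partial_fractions`). The threshold
ρ₂* is where a₂(ρ) = 2, equivalently a₃ = 3a₁.

The starting points are Chebyshev polynomials, explicit in u = ρe^{iθ}: T_n for odd n, and U_n for
every n. For 0 < λ ≤ 1 and n odd, take P = T_n; for 1 < λ ≤ 2, take P = U_n. Since Q/P is even,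
averaging its partial fractions over z and -z gives the weights m = x Q(x)/P'(x) at the zeros x of
P. Their sign comes from the expansion of C_n^λ(cos θ) with coefficients b_k b_{n-k}, b_k =
(λ)_k/k!. These are symmetric, and for λ ≤ 1 convex in k, so Fejér's theorem on sine sums with
convex coefficients applies after folding k ↔ n-k at a Chebyshev node. For 1 < λ ≤ 2 the same works
with parameter λ-1, after one differentiation in θ.

Larger λ are reached by steps of 1. From 2λ C_n^{λ+1} = x (C_n^λ)' + (n+2λ) C_n^λ, the quotient
C_n^{λ+1}/C_n^λ is a logarithmic derivative up to constants, and the zeros of C_n^λ lie in [-1, 1],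
so its even partial fractions have nonnegative weights.

The work is done for the recurrence polynomials `gegen`. The Jacobi-sum definition enters only
through the Gegenbauer differential equation, whose polynomial solutions form a line. -/

/-! ### Recurrence, derivative relations and differential equation. -/

/-- The Gegenbauer polynomials, defined by their three-term recurrence. -/
noncomputable def gegen (l : ℝ) : ℕ → ℝ[X]
  | 0 => 1
  | 1 => C (2 * l) * X
  | n + 2 => C (((n : ℝ) + 2)⁻¹) *
      (C (2 * ((n : ℝ) + 1 + l)) * X * gegen l (n + 1) - C ((n : ℝ) + 2 * l) * gegen l n)

theorem gegen_zero (l : ℝ) : gegen l 0 = 1 := by rw [gegen]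

theorem gegen_one (l : ℝ) : gegen l 1 = C (2 * l) * X := by rw [gegen]

theorem gegen_recurrence (l : ℝ) (n : ℕ) :
    ((n : ℝ[X]) + 2) * gegen l (n + 2) =
      2 * ((n : ℝ[X]) + 1 + C l) * X * gegen l (n + 1) - ((n : ℝ[X]) + 2 * C l) * gegen l n := by
  have h : ((n : ℝ[X]) + 2) * C (((n : ℝ) + 2)⁻¹) = 1 := by
    have h2 : ((n : ℝ[X]) + 2) = C ((n : ℝ) + 2) := by simp [map_ofNat]
    rw [h2, ← C_mul, mul_inv_cancel₀ (by positivity), C_1]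
  rw [gegen, ← mul_assoc, h]
  simp only [C_mul, C_add, C_1, map_ofNat, map_natCast]
  ring

/-- The two first-order relations are proved together: the differentiated recurrence yields the next
instance of the first from the second, and the second then follows from both. -/
theorem gegen_derivative_aux (l : ℝ) (n : ℕ) :
    derivative (gegen l (n + 1)) =
        X * derivative (gegen l n) + ((n : ℝ[X]) + 2 * C l) * gegen l n ∧
      X * derivative (gegen l (n + 1)) - derivative (gegen l n) =
        ((n : ℝ[X]) + 1) * gegen l (n + 1) := by
  induction n with
  | zero =>
    simp only [zero_add, gegen_zero, gegen_one, derivative_C_mul, derivative_X, derivative_one,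
      Nat.cast_zero]
    simp only [C_mul, map_ofNat]
    constructor <;> ring
  | succ n ih =>
    obtain ⟨h1, h2⟩ := ih
    have hn : ((n : ℝ[X]) + 2) ≠ 0 := by exact_mod_cast (show (n + 2) ≠ 0 by omega)
    have hr := gegen_recurrence l n
    have hd := congrArg derivative hr
    simp only [derivative_mul, derivative_sub, derivative_add, derivative_C, derivative_X,
      derivative_natCast, derivative_one, derivative_ofNat] at hd
    push_cast
    have k1 : derivative (gegen l (n + 1 + 1)) = X * derivative (gegen l (n + 1)) +
        ((n : ℝ[X]) + 1 + 2 * C l) * gegen l (n + 1) := by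
      apply mul_left_cancel₀ hn
      linear_combination hd + ((n : ℝ[X]) + 2 * C l) * h2
    refine ⟨k1, ?_⟩
    rw [k1]
    linear_combination X * h2 - h1 - hr

theorem derivative_gegen_succ (l : ℝ) (n : ℕ) :
    derivative (gegen l (n + 1)) =
      X * derivative (gegen l n) + ((n : ℝ[X]) + 2 * C l) * gegen l n :=
  (gegen_derivative_aux l n).1

theorem X_mul_derivative_gegen_succ (l : ℝ) (n : ℕ) :
    X * derivative (gegen l (n + 1)) - derivative (gegen l n) =
      ((n : ℝ[X]) + 1) * gegen l (n + 1) :=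
  (gegen_derivative_aux l n).2

theorem derivative_gegen_eq (l : ℝ) (n : ℕ) :
    derivative (gegen l (n + 1)) = 2 * C l * gegen (l + 1) n := by
  induction n using Nat.strong_induction_on with
  | _ n ih =>
    match n with
    | 0 => simp [gegen_zero, gegen_one, map_ofNat]
    | 1 =>
      rw [derivative_gegen_succ, gegen_one, gegen_one]
      simp only [derivative_C_mul, derivative_X]
      simp only [C_mul, map_ofNat, C_add, C_1, Nat.cast_one]
      ring
    | n + 2 =>
      have hn : ((n : ℝ[X]) + 2) ≠ 0 := by exact_mod_cast (show (n + 2) ≠ 0 by omega)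
      apply mul_left_cancel₀ hn
      have i1 := ih (n + 1) (by omega)
      have i0 := ih n (by omega)
      have h1 := derivative_gegen_succ l (n + 2)
      have h2 := X_mul_derivative_gegen_succ l (n + 1)
      have hr := gegen_recurrence (l + 1) n
      push_cast [C_add, C_1] at h1 h2 hr i1 i0 ⊢
      linear_combination ((n : ℝ[X]) + 2) * h1 + 2 * ((n : ℝ[X]) + 2 + C l) * X * i1
        - 2 * C l * hr - ((n : ℝ[X]) + 2 + 2 * C l) * h2 - ((n : ℝ[X]) + 2 + 2 * C l) * i0

/-- Dividing by `gegen l n` turns the right side into a logarithmic derivative, the source of the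
partial fractions in the step from λ to λ+1. -/
theorem gegen_add_one (l : ℝ) (n : ℕ) :
    2 * C l * gegen (l + 1) n =
      X * derivative (gegen l n) + ((n : ℝ[X]) + 2 * C l) * gegen l n := by
  rw [← derivative_gegen_eq, derivative_gegen_succ]

theorem gegen_ode (l : ℝ) (n : ℕ) :
    (1 - X ^ 2) * derivative (derivative (gegen l n)) -
      (2 * C l + 1) * X * derivative (gegen l n) +
      (n : ℝ[X]) * ((n : ℝ[X]) + 2 * C l) * gegen l n = 0 := by
  cases n with
  | zero => simp [gegen_zero]
  | succ n =>
    have h1 := derivative_gegen_succ l n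
    have h2 := X_mul_derivative_gegen_succ l n
    have h3 : (X ^ 2 - 1) * derivative (gegen l (n + 1)) =
        ((n : ℝ[X]) + 1) * X * gegen l (n + 1) - ((n : ℝ[X]) + 2 * C l) * gegen l n := by
      linear_combination X * h2 - h1
    have hd := congrArg derivative h3
    simp only [derivative_mul, derivative_sub, derivative_add, derivative_C, derivative_X,
      derivative_natCast, derivative_one, derivative_ofNat, derivative_X_pow] at hd
    push_cast at hd ⊢
    simp only [map_ofNat] at hd
    linear_combination -hd - ((n : ℝ[X]) + 2 * C l) * h2

/-! ### Positivity and location of the zeros. -/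

/-- Value and derivative are propagated jointly: (n+1)C_{n+1} = (x²-1)C_n' + (n+2λ)x C_n has only
nonnegative terms for x ≥ 1. -/
theorem gegen_eval_pos_aux {l : ℝ} (hl : 0 < l) {x : ℝ} (hx : 1 ≤ x) (n : ℕ) :
    0 < (gegen l n).eval x ∧ 0 ≤ (derivative (gegen l n)).eval x := by
  induction n with
  | zero => simp [gegen_zero]
  | succ n ih =>
    obtain ⟨h0, h1⟩ := ih
    have e1 := congrArg (eval x) (derivative_gegen_succ l n)
    have e2 := congrArg (eval x) (X_mul_derivative_gegen_succ l n)
    simp only [eval_add, eval_sub, eval_mul, eval_X, eval_C, eval_natCast, eval_ofNat,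
      eval_one] at e1 e2
    have hn : (0 : ℝ) ≤ n := Nat.cast_nonneg n
    have hp : 0 < (↑n + 2 * l) * eval x (gegen l n) := by positivity
    have hx0 : 0 < x := by linarith
    refine ⟨?_, ?_⟩
    · have : 0 < ((n : ℝ) + 1) * eval x (gegen l (n + 1)) := by
        rw [← e2, e1]
        have a1 : 0 ≤ (x * x - 1) * eval x (derivative (gegen l n)) :=
          mul_nonneg (by nlinarith) h1
        have a2 := mul_pos hx0 hp
        nlinarith
      exact pos_of_mul_pos_right this (by positivity)
    · rw [e1]; positivity

theorem gegen_eval_pos {l : ℝ} (hl : 0 < l) {x : ℝ} (hx : 1 ≤ x) (n : ℕ) :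
    0 < (gegen l n).eval x := (gegen_eval_pos_aux hl hx n).1

theorem gegen_ne_zero {l : ℝ} (hl : 0 < l) (n : ℕ) : gegen l n ≠ 0 := by
  intro h
  have := gegen_eval_pos hl le_rfl n
  simp [h] at this

theorem gegen_one_eq_U (n : ℕ) : gegen 1 n = Chebyshev.U ℝ n := by
  induction n using Nat.strong_induction_on with
  | _ n ih =>
    match n with
    | 0 => simp [gegen_zero]
    | 1 => simp [gegen_one, map_ofNat]
    | n + 2 =>
      have hn : ((n : ℝ[X]) + 2) ≠ 0 := by exact_mod_cast (show (n + 2) ≠ 0 by omega)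
      apply mul_left_cancel₀ hn
      rw [gegen_recurrence, ih (n + 1) (by omega), ih n (by omega)]
      push_cast
      rw [Chebyshev.U_add_two]
      simp only [C_1]
      ring

section complex

variable (l : ℝ)

theorem aeval_gegen_recurrence (n : ℕ) (z : ℂ) :
    ((n : ℂ) + 2) * aeval z (gegen l (n + 2)) =
      2 * ((n : ℂ) + 1 + l) * z * aeval z (gegen l (n + 1)) -
        ((n : ℂ) + 2 * l) * aeval z (gegen l n) := by
  have h := congrArg (aeval z) (gegen_recurrence l n)
  simpa [map_ofNat] using h

theorem aeval_neg_gegen (n : ℕ) (z : ℂ) :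
    aeval (-z) (gegen l n) = (-1) ^ n * aeval z (gegen l n) := by
  induction n using Nat.strong_induction_on with
  | _ n ih =>
    match n with
    | 0 => simp [gegen_zero]
    | 1 => simp [gegen_one]
    | n + 2 =>
      have hn : ((n : ℂ) + 2) ≠ 0 := by exact_mod_cast (show (n + 2) ≠ 0 by omega)
      apply mul_left_cancel₀ hn
      rw [aeval_gegen_recurrence, ih (n + 1) (by omega), ih n (by omega)]
      linear_combination -(-1) ^ n * aeval_gegen_recurrence l n z

/-- On the positive imaginary axis the minus sign of the recurrence is absorbed by i² = -1, so
nothing cancels. The common phase iⁿ makes quotients at the end of the minor axis positive. -/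
theorem aeval_gegen_I_mul {l : ℝ} (hl : 0 < l) {b : ℝ} (hb : 0 < b) (n : ℕ) :
    ∃ g : ℝ, 0 < g ∧ aeval (Complex.I * b) (gegen l n) = Complex.I ^ n * g := by
  induction n using Nat.strong_induction_on with
  | _ n ih =>
    match n with
    | 0 => exact ⟨1, one_pos, by simp [gegen_zero]⟩
    | 1 => exact ⟨2 * l * b, by positivity, by simp [gegen_one]; ring⟩
    | n + 2 =>
      obtain ⟨g1, p1, h1⟩ := ih (n + 1) (by omega)
      obtain ⟨g0, p0, h0⟩ := ih n (by omega)
      have hn : ((n : ℂ) + 2) ≠ 0 := by exact_mod_cast (show (n + 2) ≠ 0 by omega)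
      refine ⟨(2 * (n + 1 + l) * b * g1 + (n + 2 * l) * g0) / (n + 2), by positivity, ?_⟩
      apply mul_left_cancel₀ hn
      rw [aeval_gegen_recurrence, h1, h0]
      push_cast
      field_simp
      linear_combination (-(n + 2 * l) * g0 * Complex.I ^ n) * Complex.I_sq

/-- Consecutive values have a quotient in the upper half-plane. -/
theorem gegen_im_pos {l : ℝ} (hl : 0 < l) {z : ℂ} (hz : 0 < z.im) (n : ℕ) :
    aeval z (gegen l n) ≠ 0 ∧
      0 < (aeval z (gegen l (n + 1)) / aeval z (gegen l n)).im := by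
  induction n with
  | zero =>
    simp [gegen_zero, gegen_one, hl, hz]
  | succ n ih =>
    obtain ⟨h0, h1⟩ := ih
    have hne : aeval z (gegen l (n + 1)) ≠ 0 := by
      intro h; simp [h] at h1
    refine ⟨hne, ?_⟩
    set q := aeval z (gegen l (n + 1)) / aeval z (gegen l n) with hq
    have hq0 : q ≠ 0 := div_ne_zero hne h0
    have hn : ((n : ℂ) + 2) ≠ 0 := by exact_mod_cast (show (n + 2) ≠ 0 by omega)
    -- The next quotient is αz - β/q with α, β > 0; both z and -1/q lie in the upper half-plane.
    have key : aeval z (gegen l (n + 1 + 1)) / aeval z (gegen l (n + 1)) =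
        ((2 * ((n : ℝ) + 1 + l) / (n + 2) : ℝ) : ℂ) * z -
          (((n + 2 * l) / (n + 2) : ℝ) : ℂ) * q⁻¹ := by
      have := aeval_gegen_recurrence l n z
      rw [hq, inv_div, div_eq_iff hne]
      push_cast
      field_simp
      linear_combination this
    rw [key, Complex.sub_im, Complex.im_ofReal_mul, Complex.im_ofReal_mul, Complex.inv_im]
    have c1 : 0 < 2 * ((n : ℝ) + 1 + l) / (n + 2) * z.im := by positivity
    have c2 : 0 < ((n : ℝ) + 2 * l) / (n + 2) * (q.im / Complex.normSq q) := by
      have := Complex.normSq_pos.2 hq0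
      positivity
    rw [neg_div, mul_neg, sub_neg_eq_add]
    exact add_pos c1 c2

theorem aeval_conj (p : ℝ[X]) (z : ℂ) :
    aeval ((starRingEnd ℂ) z) p = (starRingEnd ℂ) (aeval z p) := by
  simpa using aeval_algHom_apply Complex.conjAe.toAlgHom z p

/-- The complex zeros of a Gegenbauer polynomial lie in `[-1, 1]`. -/
theorem gegen_roots_mem {l : ℝ} (hl : 0 < l) {n : ℕ} {z : ℂ} (hz : aeval z (gegen l n) = 0) :
    ∃ x : ℝ, |x| ≤ 1 ∧ z = x := by
  have him : z.im = 0 := by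
    rcases lt_trichotomy z.im 0 with h | h | h
    · have h1 : 0 < ((starRingEnd ℂ) z).im := by simpa using h
      exact absurd (by rw [aeval_conj, hz, map_zero]) (gegen_im_pos hl h1 n).1
    · exact h
    · exact absurd hz (gegen_im_pos hl h n).1
  obtain ⟨x, rfl⟩ : ∃ x : ℝ, z = x := ⟨z.re, by apply Complex.ext <;> simp [him]⟩
  have hreal : ∀ y : ℝ, aeval (y : ℂ) (gegen l n) = 0 → y < 1 := by
    intro y hy
    by_contra! h
    have h2 := gegen_eval_pos hl h n
    have h3 : aeval (algebraMap ℝ ℂ y) (gegen l n) = 0 := hy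
    rw [aeval_algebraMap_apply_eq_algebraMap_eval] at h3
    simp only [Complex.coe_algebraMap, Complex.ofReal_eq_zero] at h3
    linarith
  refine ⟨x, abs_le.2 ⟨?_, (hreal x hz).le⟩, rfl⟩
  have := hreal (-x) (by rw [Complex.ofReal_neg, aeval_neg_gegen, hz, mul_zero])
  linarith

end complex

/-! ### Identification with the Jacobi sum through the differential equation. -/

/-- The Gegenbauer differential operator. -/
noncomputable def gegenOp (l : ℝ) (n : ℕ) : ℝ[X] →ₗ[ℝ] ℝ[X] :=
  LinearMap.mulLeft ℝ (1 - X ^ 2) ∘ₗ derivative ∘ₗ derivative -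
    LinearMap.mulLeft ℝ ((2 * C l + 1) * X) ∘ₗ derivative +
    LinearMap.mulLeft ℝ ((n : ℝ[X]) * ((n : ℝ[X]) + 2 * C l))

theorem gegenOp_apply (l : ℝ) (n : ℕ) (p : ℝ[X]) :
    gegenOp l n p = (1 - X ^ 2) * derivative (derivative p) -
      (2 * C l + 1) * X * derivative p + (n : ℝ[X]) * ((n : ℝ[X]) + 2 * C l) * p := rfl

theorem coeff_X_mul_derivative (p : ℝ[X]) (m : ℕ) :
    (X * derivative p).coeff m = m * p.coeff m := by
  cases m with
  | zero => simp
  | succ m => rw [coeff_X_mul, coeff_derivative]; push_cast; ring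

/-- The operator multiplies a leading coefficient in degree m by (n-m)(n+m+2λ), which vanishes only
for m = n. Hence polynomial solutions are determined up to a scalar. -/
theorem natDegree_of_gegenOp_eq_zero {l : ℝ} (hl : 0 < l) {n : ℕ} {p : ℝ[X]} (hp : p ≠ 0)
    (h : gegenOp l n p = 0) : p.natDegree = n := by
  have e : gegenOp l n p = derivative (derivative p) -
      X * derivative (X * derivative p) - C (2 * l) * (X * derivative p) +
      C ((n : ℝ) * (n + 2 * l)) * p := by
    rw [gegenOp_apply, derivative_mul, derivative_X]
    simp only [C_mul, C_add, map_natCast, map_ofNat]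
    ring
  set m := p.natDegree
  have hc := congrArg (fun q => coeff q m) (e.symm.trans h)
  have h2 : (derivative (derivative p)).coeff m = 0 := by
    rw [coeff_derivative, coeff_derivative,
      coeff_eq_zero_of_natDegree_lt (show p.natDegree < m + 1 + 1 by omega)]
    simp
  simp only [coeff_add, coeff_sub, coeff_C_mul, coeff_X_mul_derivative, h2, coeff_zero] at hc
  have hlead : p.coeff m ≠ 0 := leadingCoeff_ne_zero.2 hp
  have : ((n : ℝ) - m) * ((n : ℝ) + m + 2 * l) = 0 := by
    apply mul_right_cancel₀ hlead
    linear_combination hc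
  rcases mul_eq_zero.1 this with h | h
  · exact_mod_cast (sub_eq_zero.1 h).symm
  · have : 0 < (n : ℝ) + m + 2 * l := by positivity
    linarith

theorem gegenOp_gegen (l : ℝ) (n : ℕ) : gegenOp l n (gegen l n) = 0 := gegen_ode l n

theorem natDegree_gegen {l : ℝ} (hl : 0 < l) (n : ℕ) : (gegen l n).natDegree = n :=
  natDegree_of_gegenOp_eq_zero hl (gegen_ne_zero hl n) (gegenOp_gegen l n)

theorem eq_C_mul_gegen {l : ℝ} (hl : 0 < l) {n : ℕ} {p : ℝ[X]} (h : gegenOp l n p = 0) :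
    ∃ κ : ℝ, p = C κ * gegen l n := by
  have hd := natDegree_gegen hl n
  have hlead : (gegen l n).coeff n ≠ 0 := by
    have := leadingCoeff_ne_zero.2 (gegen_ne_zero hl n)
    rwa [leadingCoeff, hd] at this
  refine ⟨p.coeff n / (gegen l n).coeff n, ?_⟩
  by_contra hne
  have hq : p - C (p.coeff n / (gegen l n).coeff n) * gegen l n ≠ 0 := sub_ne_zero.2 hne
  have hop : gegenOp l n (p - C (p.coeff n / (gegen l n).coeff n) * gegen l n) = 0 := by
    rw [← smul_eq_C_mul, map_sub, map_smul, h, gegenOp_gegen]; simp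
  have := natDegree_of_gegenOp_eq_zero hl hq hop
  have h0 := leadingCoeff_ne_zero.2 hq
  rw [leadingCoeff, this, coeff_sub, coeff_C_mul, div_mul_cancel₀ _ hlead, sub_self] at h0
  exact h0 rfl

theorem ringChoose_succ (a : ℝ) (k : ℕ) :
    ((k : ℝ) + 1) * Ring.choose a (k + 1) = (a - k) * Ring.choose a k := by
  have h1 := Ring.descPochhammer_eq_factorial_smul_choose a k
  have h2 := Ring.descPochhammer_eq_factorial_smul_choose a (k + 1)
  rw [descPochhammer_succ_right, smeval_mul, h1] at h2
  have hf : ((k.factorial : ℕ) : ℝ) ≠ 0 := by positivity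
  apply mul_left_cancel₀ hf
  simp only [smeval_sub, smeval_X, smeval_natCast, nsmul_eq_mul, pow_one, pow_zero, mul_one,
    Nat.factorial_succ, Nat.cast_mul, Nat.cast_add, Nat.cast_one] at h2
  linear_combination -h2

/-- The terms `(x - 1)^k (x + 1)^j` under the Gegenbauer operator, with `j + k = n`. -/
theorem gegenOp_term (α : ℝ) (j k : ℕ) :
    gegenOp (α + 1 / 2) (j + k) ((X - 1) ^ k * (X + 1) ^ j) =
      C (2 * j * (j + α)) * ((X - 1) ^ k * (X + 1) ^ (j - 1)) -
      C (2 * k * (k + α)) * ((X - 1) ^ (k - 1) * (X + 1) ^ j) := by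
  rw [gegenOp_apply]
  have hL : 2 * C (α + 1 / 2) = 2 * C α + 1 := by
    rw [C_add, mul_add]
    congr 1
    rw [← map_ofNat C 2, ← C_mul]; norm_num
  have hd1 : ∀ k : ℕ, derivative ((X - 1 : ℝ[X]) ^ k) = (k : ℝ[X]) * (X - 1) ^ (k - 1) := by
    intro k; simp [derivative_pow]
  have hd2 : ∀ k : ℕ, derivative ((X + 1 : ℝ[X]) ^ k) = (k : ℝ[X]) * (X + 1) ^ (k - 1) := by
    intro k; simp [derivative_pow]
  simp only [hL, derivative_mul, hd1, hd2, derivative_add, derivative_natCast]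
  simp only [C_mul, C_add, map_ofNat, map_natCast]
  rcases j with _ | _ | j <;> rcases k with _ | _ | k <;>
    simp only [Nat.cast_add, Nat.cast_one, Nat.cast_zero, add_tsub_cancel_right,
      zero_add, zero_tsub, pow_zero, tsub_self] <;> ring

theorem gegenOp_jacobiPoly (α : ℝ) (n : ℕ) :
    gegenOp (α + 1 / 2) n (jacobiPoly α α n) = 0 := by
  rw [jacobiPoly, ← smul_eq_C_mul, map_smul, map_sum]
  set b : ℕ → ℝ := fun k => Ring.choose ((n : ℝ) + α) (n - k) * Ring.choose ((n : ℝ) + α) k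
  -- This ratio of consecutive coefficients matches the two neighbouring terms produced by
  -- `gegenOp_term`, so the image of the sum telescopes.
  have hb : ∀ k < n, ((k : ℝ) + 1) * (k + 1 + α) * b (k + 1) = (n - k) * (n - k + α) * b k := by
    intro k hk
    obtain ⟨j, rfl⟩ : ∃ j, n = j + 1 + k := ⟨n - k - 1, by omega⟩
    have e1 : j + 1 + k - (k + 1) = j := by omega
    have e2 : j + 1 + k - k = j + 1 := by omega
    simp only [b, e1, e2]
    have h1 := ringChoose_succ (((j + 1 + k : ℕ) : ℝ) + α) k
    have h2 := ringChoose_succ (((j + 1 + k : ℕ) : ℝ) + α) j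
    push_cast at h1 h2 ⊢
    linear_combination (k + 1 + α) * Ring.choose ((j : ℝ) + 1 + k + α) j * h1 -
      (j + 1 + α) * Ring.choose ((j : ℝ) + 1 + k + α) k * h2
  -- The cutoff is needed at k = n+1, where the truncated subtraction n - k would leave a spurious
  -- term; at k = 0 the factor k already gives zero.
  set E : ℕ → ℝ[X] := fun k =>
    if k ≤ n then C (2 * k * (k + α) * b k) * ((X - 1) ^ (k - 1) * (X + 1) ^ (n - k)) else 0
  have hE : ∀ k ∈ Finset.range (n + 1), gegenOp (α + 1 / 2) n
      (C (b k) * ((X - 1) ^ k * (X + 1) ^ (n - k))) = E (k + 1) - E k := by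
    intro k hk
    have hk' : k ≤ n := Nat.lt_succ_iff.1 (Finset.mem_range.1 hk)
    have ht := gegenOp_term α (n - k) k
    rw [Nat.sub_add_cancel hk'] at ht
    have hassoc : ∀ (x y : ℝ) (A : ℝ[X]), C x * (C y * A) = C (x * y) * A := fun x y A => by
      rw [C_mul, mul_assoc]
    rw [← smul_eq_C_mul, map_smul, ht, smul_sub, smul_eq_C_mul, smul_eq_C_mul, hassoc, hassoc]
    congr 1
    · by_cases h : k < n
      · simp only [E, if_pos (Nat.succ_le_of_lt h), add_tsub_cancel_right, Nat.sub_sub]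
        congr 2
        have := hb k h
        push_cast [Nat.cast_sub hk']
        linear_combination -2 * this
      · have : k = n := by omega
        subst this
        simp [E]
    · simp only [E, if_pos hk']
      congr 2
      ring
  rw [Finset.sum_congr rfl hE, Finset.sum_range_sub]
  simp [E]

/-- The Gamma-function normalization need not be evaluated: scaling by any real κ preserves where
the modulus is minimal. -/
theorem gegenbauerPoly_eq {l : ℝ} (hl : 0 < l) (n : ℕ) :
    ∃ κ : ℝ, gegenbauerPoly l n = C κ * gegen l n := by
  have h := gegenOp_jacobiPoly (l - 1 / 2) n
  rw [sub_add_cancel] at h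
  obtain ⟨κ, hκ⟩ := eq_C_mul_gegen hl h
  exact ⟨_, by rw [gegenbauerPoly, hκ, ← mul_assoc, ← C_mul]⟩

/-! ### Fejér's sine sums. -/

theorem abs_sin_nat_mul_le (n : ℕ) (x : ℝ) : |Real.sin (n * x)| ≤ n * |Real.sin x| := by
  induction n with
  | zero => simp
  | succ n ih =>
    push_cast
    rw [add_mul, one_mul, Real.sin_add]
    calc _ ≤ |Real.sin (n * x) * Real.cos x| + |Real.cos (n * x) * Real.sin x| := abs_add_le _ _
      _ ≤ |Real.sin (n * x)| * 1 + 1 * |Real.sin x| := by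
        rw [abs_mul, abs_mul]
        gcongr <;> exact Real.abs_cos_le_one _
      _ ≤ _ := by linarith

/-- Summation by parts twice. The boundary terms are kept so that induction on K works; they vanish
once e is zero from K on. -/
theorem sin_mul_sum_identity (e : ℕ → ℝ) (φ : ℝ) (K : ℕ) :
    (2 - 2 * Real.cos φ) * ∑ k ∈ Finset.range K, e k * Real.sin (k * φ) =
      ∑ k ∈ Finset.range K, (e k - 2 * e (k + 1) + e (k + 2)) *
        ((k + 1) * Real.sin φ - Real.sin ((k + 1) * φ)) +
      (((K + 1) * Real.sin φ - Real.sin ((K + 1) * φ) -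
        (2 - 2 * Real.cos φ) * Real.sin (K * φ)) * e K -
        (K * Real.sin φ - Real.sin (K * φ)) * e (K + 1)) := by
  induction K with
  | zero => simp
  | succ K ih =>
    rw [Finset.sum_range_succ, Finset.sum_range_succ, mul_add, ih]
    have h : Real.sin ((K + 1 + 1) * φ) =
        2 * Real.cos φ * Real.sin ((K + 1) * φ) - Real.sin (K * φ) := by
      have e1 : ((K : ℝ) + 1 + 1) * φ = (K + 1) * φ + φ := by ring
      have e2 : (K : ℝ) * φ = (K + 1) * φ - φ := by ring
      rw [e1, e2, Real.sin_add, Real.sin_sub]; ring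
    push_cast
    rw [h]
    ring

/-- Fejér: sine sums with convex coefficients that eventually vanish have the sign of `sin φ`. -/
theorem sin_mul_sum_nonneg {e : ℕ → ℝ} {K : ℕ} (h0 : ∀ k, K ≤ k → e k = 0)
    (hc : ∀ k, 0 ≤ e k - 2 * e (k + 1) + e (k + 2)) (φ : ℝ) :
    0 ≤ Real.sin φ * ∑ k ∈ Finset.range K, e k * Real.sin (k * φ) := by
  have hid := sin_mul_sum_identity e φ K
  rw [h0 K le_rfl, h0 (K + 1) (by omega), mul_zero, mul_zero, sub_zero, add_zero] at hid
  have hterm : 0 ≤ Real.sin φ * ∑ k ∈ Finset.range K, (e k - 2 * e (k + 1) + e (k + 2)) *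
        ((k + 1) * Real.sin φ - Real.sin ((k + 1) * φ)) := by
    rw [Finset.mul_sum]
    refine Finset.sum_nonneg fun k _ => ?_
    have hb := abs_sin_nat_mul_le (k + 1) φ
    push_cast at hb
    have h1 : Real.sin φ * Real.sin ((k + 1) * φ) ≤ (k + 1) * (Real.sin φ * Real.sin φ) := by
      calc _ ≤ |Real.sin φ * Real.sin ((k + 1) * φ)| := le_abs_self _
        _ = |Real.sin φ| * |Real.sin ((k + 1) * φ)| := abs_mul _ _
        _ ≤ |Real.sin φ| * ((k + 1) * |Real.sin φ|) := by gcongr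
        _ = (k + 1) * (|Real.sin φ| * |Real.sin φ|) := by ring
        _ = _ := by rw [abs_mul_abs_self]
    have := mul_nonneg (hc k) (sub_nonneg.2 h1)
    linarith
  rw [← hid] at hterm
  rcases eq_or_lt_of_le (Real.cos_le_one φ) with h | h
  · have : Real.sin φ = 0 := by
      have := Real.sin_sq_add_cos_sq φ
      rw [h] at this
      nlinarith
    simp [this]
  · have hp : 0 < 2 - 2 * Real.cos φ := by linarith
    have : 0 ≤ (2 - 2 * Real.cos φ) *
        (Real.sin φ * ∑ k ∈ Finset.range K, e k * Real.sin (k * φ)) := by linarith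
    exact nonneg_of_mul_nonneg_right this hp

/-! ### Binomial coefficients and trigonometric expansion. -/

/-- The coefficients `(l)_k / k!` of `(1 - x)^{-l}`. -/
noncomputable def binomCoeff (l : ℝ) : ℕ → ℝ
  | 0 => 1
  | k + 1 => (k + l) / (k + 1) * binomCoeff l k

theorem binomCoeff_succ (l : ℝ) (k : ℕ) :
    ((k : ℝ) + 1) * binomCoeff l (k + 1) = (k + l) * binomCoeff l k := by
  rw [binomCoeff]; field_simp

theorem binomCoeff_pos {l : ℝ} (hl : 0 < l) (k : ℕ) : 0 < binomCoeff l k := by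
  induction k with
  | zero => simp [binomCoeff]
  | succ k ih => rw [binomCoeff]; positivity

/-- The ratio b_{k+1}/b_k = (k+λ)/(k+1) is nondecreasing exactly because λ ≤ 1; this is
log-convexity. -/
theorem binomCoeff_mul_le {l : ℝ} (hl : 0 < l) (hl1 : l ≤ 1) {k j : ℕ} (h : k ≤ j) :
    binomCoeff l (k + 1) * binomCoeff l j ≤ binomCoeff l k * binomCoeff l (j + 1) := by
  rw [binomCoeff, binomCoeff]
  have hr : ((k : ℝ) + l) / (k + 1) ≤ (j + l) / (j + 1) := by
    have : (k : ℝ) ≤ j := by exact_mod_cast h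
    rw [div_le_div_iff₀ (by positivity) (by positivity)]
    nlinarith
  have := mul_le_mul_of_nonneg_right hr
    (mul_pos (binomCoeff_pos hl k) (binomCoeff_pos hl j)).le
  linarith

/-- Log-convexity bounds the square of the middle product by the product of the outer two; the
inequality of arithmetic and geometric means finishes. -/
theorem binomCoeff_convex {l : ℝ} (hl : 0 < l) (hl1 : l ≤ 1) (k j : ℕ) :
    0 ≤ binomCoeff l k * binomCoeff l (j + 2) -
      2 * (binomCoeff l (k + 1) * binomCoeff l (j + 1)) +
      binomCoeff l (k + 2) * binomCoeff l j := by
  have hk := binomCoeff_mul_le hl hl1 (Nat.le_succ k)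
  have hj := binomCoeff_mul_le hl hl1 (Nat.le_succ j)
  have p : ∀ k, 0 < binomCoeff l k := binomCoeff_pos hl
  simp only [Nat.succ_eq_add_one, add_assoc, one_add_one_eq_two] at hk hj
  have hm := mul_le_mul hk hj (mul_pos (p _) (p _)).le (mul_pos (p _) (p _)).le
  have h1 := mul_pos (p k) (p (j + 2))
  have h2 := mul_pos (p (k + 1)) (p (j + 1))
  have h3 := mul_pos (p (k + 2)) (p j)
  nlinarith [sq_nonneg (binomCoeff l k * binomCoeff l (j + 2) -
    binomCoeff l (k + 2) * binomCoeff l j)]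

section series

open PowerSeries in
theorem binomSeries_derivative (l : ℝ) (u : ℂ) :
    (1 - PowerSeries.C u * PowerSeries.X) *
        d⁄dX ℂ (PowerSeries.mk fun k => (binomCoeff l k : ℂ) * u ^ k) =
      PowerSeries.C (l * u) * PowerSeries.mk fun k => (binomCoeff l k : ℂ) * u ^ k := by
  ext n
  have hb : ((n : ℂ) + 1) * binomCoeff l (n + 1) = (n + l) * binomCoeff l n := by
    exact_mod_cast binomCoeff_succ l n
  rw [sub_mul, one_mul, map_sub, mul_assoc, PowerSeries.coeff_C_mul, PowerSeries.coeff_C_mul,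
    PowerSeries.coeff_derivative, PowerSeries.coeff_mk, PowerSeries.coeff_mk]
  cases n with
  | zero =>
    rw [PowerSeries.coeff_zero_X_mul]
    push_cast at hb ⊢
    linear_combination u * hb
  | succ n =>
    rw [PowerSeries.coeff_succ_X_mul, PowerSeries.coeff_derivative, PowerSeries.coeff_mk]
    push_cast at hb ⊢
    linear_combination u ^ (n + 2) * hb

-- The Cauchy product of (1-uX)^{-λ} and (1-u⁻¹X)^{-λ} is the generating function (1-2zX+X²)^{-λ}.
-- Its first-order differential equation, read coefficientwise, is the Gegenbauer recurrence.
open PowerSeries in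
theorem aeval_gegen_eq_sum (l : ℝ) (n : ℕ) {u : ℂ} (hu : u ≠ 0) :
    aeval ((u + u⁻¹) / 2) (gegen l n) = ∑ k ∈ Finset.range (n + 1),
      (binomCoeff l k : ℂ) * binomCoeff l (n - k) * (u ^ k * u⁻¹ ^ (n - k)) := by
  set z := (u + u⁻¹) / 2 with hz
  set A := PowerSeries.mk fun k => (binomCoeff l k : ℂ) * u ^ k with hA
  set B := PowerSeries.mk fun k => (binomCoeff l k : ℂ) * u⁻¹ ^ k with hB
  have hcoeff : ∀ n, PowerSeries.coeff n (A * B) = ∑ k ∈ Finset.range (n + 1),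
      (binomCoeff l k : ℂ) * binomCoeff l (n - k) * (u ^ k * u⁻¹ ^ (n - k)) := by
    intro n
    rw [PowerSeries.coeff_mul, Finset.Nat.sum_antidiagonal_eq_sum_range_succ_mk]
    refine Finset.sum_congr rfl fun k _ => ?_
    simp only [hA, hB, PowerSeries.coeff_mk]
    ring
  rw [← hcoeff]
  have h1 := binomSeries_derivative l u
  have h2 := binomSeries_derivative l u⁻¹
  rw [← hA] at h1
  rw [← hB] at h2
  set F := A * B with hF
  have hCC : PowerSeries.C u * PowerSeries.C u⁻¹ = (1 : ℂ⟦X⟧) := by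
    rw [← map_mul, mul_inv_cancel₀ hu, map_one]
  have hode : d⁄dX ℂ F - PowerSeries.C (2 * z) * (PowerSeries.X * d⁄dX ℂ F) +
      PowerSeries.X * (PowerSeries.X * d⁄dX ℂ F) =
      PowerSeries.C (2 * l * z) * F - PowerSeries.C (2 * l : ℂ) * (PowerSeries.X * F) := by
    have hz2 : 2 * z = u + u⁻¹ := by rw [hz]; ring
    have hlz : 2 * (l : ℂ) * z = l * u + l * u⁻¹ := by rw [hz]; ring
    rw [hF, Derivation.leibniz, hz2, hlz]
    simp only [smul_eq_mul, map_add, map_mul] at h1 h2 ⊢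
    have e2 : (PowerSeries.C (2 : ℂ)) = (2 : ℂ⟦X⟧) := map_ofNat _ 2
    rw [e2]
    linear_combination (1 - PowerSeries.C u⁻¹ * PowerSeries.X) * B * h1 +
      (1 - PowerSeries.C u * PowerSeries.X) * A * h2 -
      (PowerSeries.X ^ 2 * (A * d⁄dX ℂ B + B * d⁄dX ℂ A) +
        2 * PowerSeries.C (l : ℂ) * PowerSeries.X * A * B) * hCC
  have hF0 : PowerSeries.coeff 0 F = 1 := by
    rw [hcoeff]; simp [binomCoeff]
  have hF1 : PowerSeries.coeff 1 F = 2 * l * z := by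
    have := congrArg (PowerSeries.coeff 0) hode
    simp only [map_add, map_sub, PowerSeries.coeff_C_mul, PowerSeries.coeff_zero_X_mul,
      PowerSeries.coeff_derivative, hF0] at this
    push_cast at this
    linear_combination this
  induction n using Nat.strong_induction_on with
  | _ n ih =>
    match n with
    | 0 => rw [hF0, gegen_zero, map_one]
    | 1 => rw [hF1, gegen_one]; simp
    | n + 2 =>
      have hn : ((n : ℂ) + 2) ≠ 0 := by exact_mod_cast (show (n + 2) ≠ 0 by omega)
      apply mul_left_cancel₀ hn
      rw [aeval_gegen_recurrence, ih (n + 1) (by omega), ih n (by omega)]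
      have := congrArg (PowerSeries.coeff (n + 1)) hode
      simp only [map_add, map_sub, PowerSeries.coeff_C_mul, PowerSeries.coeff_succ_X_mul,
        PowerSeries.coeff_derivative] at this
      cases n with
      | zero =>
        rw [PowerSeries.coeff_zero_X_mul] at this
        push_cast at this ⊢
        linear_combination -this
      | succ n =>
        rw [PowerSeries.coeff_succ_X_mul, PowerSeries.coeff_derivative] at this
        push_cast at this ⊢
        linear_combination -this

end series

theorem gegen_eval_cos (l : ℝ) (n : ℕ) (θ : ℝ) :
    (gegen l n).eval (Real.cos θ) = ∑ k ∈ Finset.range (n + 1),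
      binomCoeff l k * binomCoeff l (n - k) * Real.cos ((n - 2 * k) * θ) := by
  have h := aeval_gegen_eq_sum l n (Complex.exp_ne_zero (θ * Complex.I))
  have hc : (Complex.exp (θ * Complex.I) + (Complex.exp (θ * Complex.I))⁻¹) / 2 =
      algebraMap ℝ ℂ (Real.cos θ) := by
    rw [← Complex.exp_neg, ← neg_mul, ← Complex.cos]; simp
  rw [hc, aeval_algebraMap_apply_eq_algebraMap_eval] at h
  have h2 := congrArg Complex.re h
  rw [Complex.coe_algebraMap, Complex.ofReal_re, Complex.re_sum] at h2
  rw [h2]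
  refine Finset.sum_congr rfl fun k hk => ?_
  have hk' : k ≤ n := Nat.lt_succ_iff.1 (Finset.mem_range.1 hk)
  have he : Complex.exp (θ * Complex.I) ^ k * (Complex.exp (θ * Complex.I))⁻¹ ^ (n - k) =
      Complex.exp (((-((n - 2 * k) * θ) : ℝ) : ℂ) * Complex.I) := by
    rw [← Complex.exp_neg, ← Complex.exp_nat_mul, ← Complex.exp_nat_mul, ← Complex.exp_add]
    congr 1
    push_cast [Nat.cast_sub hk']
    ring
  rw [he, ← Complex.ofReal_mul, Complex.re_ofReal_mul, Complex.exp_ofReal_mul_I_re, Real.cos_neg]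

/-- Differentiating the cosine expansion in θ reaches parameter λ+1 with coefficients still built
from λ, so the log-convexity available for λ ≤ 1 serves up to parameter 2. -/
theorem gegen_add_one_eval_cos (l : ℝ) (n : ℕ) (θ : ℝ) :
    2 * l * Real.sin θ * (gegen (l + 1) n).eval (Real.cos θ) = ∑ k ∈ Finset.range (n + 1 + 1),
      binomCoeff l k * binomCoeff l (n + 1 - k) * ((((n + 1 : ℕ) : ℝ) - 2 * k) *
        Real.sin ((((n + 1 : ℕ) : ℝ) - 2 * k) * θ)) := by
  have h1 : HasDerivAt (fun t => (gegen l (n + 1)).eval (Real.cos t))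
      ((derivative (gegen l (n + 1))).eval (Real.cos θ) * -Real.sin θ) θ :=
    ((gegen l (n + 1)).hasDerivAt (Real.cos θ)).comp θ (Real.hasDerivAt_cos θ)
  have h2 : HasDerivAt (fun t => ∑ k ∈ Finset.range (n + 1 + 1),
      binomCoeff l k * binomCoeff l (n + 1 - k) *
        Real.cos ((((n + 1 : ℕ) : ℝ) - 2 * k) * t))
      (∑ k ∈ Finset.range (n + 1 + 1), binomCoeff l k * binomCoeff l (n + 1 - k) *
        (-Real.sin ((((n + 1 : ℕ) : ℝ) - 2 * k) * θ) * ((((n + 1 : ℕ) : ℝ) - 2 * k) * 1))) θ := by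
    refine HasDerivAt.fun_sum fun k _ => ?_
    exact (((hasDerivAt_id θ).const_mul _).cos).const_mul _
  have h3 := h1.unique (h2.congr_of_eventuallyEq
    (Filter.Eventually.of_forall fun t => gegen_eval_cos l (n + 1) t))
  rw [derivative_gegen_eq] at h3
  simp only [eval_mul, eval_ofNat, eval_C] at h3
  have h4 : 2 * l * Real.sin θ * (gegen (l + 1) n).eval (Real.cos θ) =
      -(2 * l * eval (Real.cos θ) (gegen (l + 1) n) * -Real.sin θ) := by ring
  rw [h4, h3, ← Finset.sum_neg_distrib]
  exact Finset.sum_congr rfl fun k _ => by ring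

/-! ### Signs at the Chebyshev nodes. -/

/-- When sin Nθ = 0, both the coefficients and sin 2kθ are odd under k ↔ N-k. The sum is therefore
twice its half 2k ≤ N, whose coefficients, extended by zero, are convex. -/
theorem sin_two_mul_mul_sum_nonneg_of_sin_eq_zero {μ : ℝ} (hμ : 0 < μ) (hμ1 : μ ≤ 1) (N : ℕ)
    {θ : ℝ} (hθ : Real.sin (N * θ) = 0) :
    0 ≤ Real.sin (2 * θ) * ∑ k ∈ Finset.range (N + 1),
      binomCoeff μ k * binomCoeff μ (N - k) * (((N : ℝ) - 2 * k) * Real.sin (2 * k * θ)) := by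
  set e : ℕ → ℝ := fun k =>
    if 2 * k ≤ N then binomCoeff μ k * binomCoeff μ (N - k) * ((N : ℝ) - 2 * k) else 0 with he
  have p : ∀ k, 0 < binomCoeff μ k := binomCoeff_pos hμ
  have henn : ∀ k, 0 ≤ e k := by
    intro k
    simp only [he]
    split_ifs with h
    · have h' : (2 * k : ℝ) ≤ N := by exact_mod_cast h
      exact mul_nonneg (mul_pos (p _) (p _)).le (by linarith)
    · exact le_rfl
  have hconv : ∀ k, 0 ≤ e k - 2 * e (k + 1) + e (k + 2) := by
    intro k
    by_cases h : 2 * (k + 1) < N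
    · obtain ⟨j, rfl⟩ : ∃ j, N = k + 2 + j := ⟨N - (k + 2), by omega⟩
      have hkj : k + 1 ≤ j := by omega
      have hj' : (k : ℝ) + 1 ≤ j := by exact_mod_cast hkj
      have e0 : e k = binomCoeff μ k * binomCoeff μ (j + 2) * ((j : ℝ) + 2 - k) := by
        simp only [he]
        rw [if_pos (by omega), show k + 2 + j - k = j + 2 by omega]
        push_cast; ring
      have e1 : e (k + 1) = binomCoeff μ (k + 1) * binomCoeff μ (j + 1) * ((j : ℝ) - k) := by
        simp only [he]
        rw [if_pos (by omega), show k + 2 + j - (k + 1) = j + 1 by omega]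
        push_cast; ring
      have e2 : binomCoeff μ (k + 2) * binomCoeff μ j * ((j : ℝ) - 2 - k) ≤ e (k + 2) := by
        by_cases h2 : 2 * (k + 2) ≤ k + 2 + j
        · simp only [he]
          rw [if_pos h2, show k + 2 + j - (k + 2) = j by omega]
          push_cast
          apply le_of_eq; ring
        · have hj2 : (j : ℝ) ≤ k + 2 := by exact_mod_cast (show j ≤ k + 2 by omega)
          exact (mul_nonpos_of_nonneg_of_nonpos (mul_pos (p _) (p _)).le (by linarith)).trans
            (henn _)
      have hc := binomCoeff_convex hμ hμ1 k j
      have d1 := binomCoeff_mul_le hμ hμ1 (show k + 1 ≤ j from hkj)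
      have d2 := binomCoeff_mul_le hμ hμ1 (show k ≤ j + 1 by omega)
      simp only [add_assoc, one_add_one_eq_two] at d1 d2
      -- With D = j-k and products A ≥ M ≥ B in place of the coefficients, the second difference is
      -- at least D(A-2M+B) + 2(A-B).
      have hm := mul_nonneg hc (show (0 : ℝ) ≤ j - k by linarith)
      rw [e0, e1]
      nlinarith
    · have e1 : e (k + 1) = 0 := by
        simp only [he]
        split_ifs with h2
        · have : N = 2 * (k + 1) := by omega
          subst this
          push_cast; ring
        · rfl
      rw [e1]
      have := henn k
      have := henn (k + 2)
      linarith
  have hzero : ∀ k, N + 1 ≤ k → e k = 0 := fun k hk => by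
    simp only [he]; rw [if_neg (by omega)]
  have hF := sin_mul_sum_nonneg hzero hconv (2 * θ)
  have hsym : ∀ k ∈ Finset.range (N + 1),
      binomCoeff μ k * binomCoeff μ (N - k) * ((N : ℝ) - 2 * k) = e k - e (N - k) := by
    intro k hk
    have hk' : k ≤ N := Nat.lt_succ_iff.1 (Finset.mem_range.1 hk)
    simp only [he, Nat.sub_sub_self hk', Nat.cast_sub hk']
    split_ifs with h1 h2 h2
    · have : N = 2 * k := by omega
      rw [this]; push_cast; ring
    · ring
    · ring
    · omega
  have hsin : ∀ k ∈ Finset.range (N + 1),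
      Real.sin (2 * ((N - k : ℕ) : ℝ) * θ) = -Real.sin (2 * k * θ) := by
    intro k hk
    have hk' : k ≤ N := Nat.lt_succ_iff.1 (Finset.mem_range.1 hk)
    rw [Nat.cast_sub hk', show 2 * ((N : ℝ) - k) * θ = 2 * (N * θ) - 2 * k * θ by ring,
      Real.sin_sub, Real.sin_two_mul, Real.cos_two_mul', hθ]
    have := Real.sin_sq_add_cos_sq (N * θ)
    rw [hθ] at this
    linear_combination -Real.sin (2 * k * θ) * this
  have hflip : ∑ k ∈ Finset.range (N + 1), e (N - k) * Real.sin (2 * k * θ) =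
      -∑ k ∈ Finset.range (N + 1), e k * Real.sin (2 * k * θ) := by
    rw [← Finset.sum_flip (fun k => e k * Real.sin (2 * k * θ)), ← Finset.sum_neg_distrib]
    refine Finset.sum_congr rfl fun k hk => ?_
    rw [hsin k hk]; ring
  have hsum : ∑ k ∈ Finset.range (N + 1), binomCoeff μ k * binomCoeff μ (N - k) *
      (((N : ℝ) - 2 * k) * Real.sin (2 * k * θ)) =
      2 * ∑ k ∈ Finset.range (N + 1), e k * Real.sin (k * (2 * θ)) := by
    have : ∀ k ∈ Finset.range (N + 1), binomCoeff μ k * binomCoeff μ (N - k) *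
        (((N : ℝ) - 2 * k) * Real.sin (2 * k * θ)) =
        e k * Real.sin (2 * k * θ) - e (N - k) * Real.sin (2 * k * θ) := fun k hk => by
      rw [← sub_mul, ← hsym k hk]; ring
    rw [Finset.sum_congr rfl this, Finset.sum_sub_distrib, hflip, sub_neg_eq_add, ← two_mul]
    congr 1
    exact Finset.sum_congr rfl fun k _ => by rw [show 2 * (k : ℝ) * θ = k * (2 * θ) by ring]
  rw [hsum]
  linarith

theorem two_sin_mul_sum_sin (φ : ℝ) (n : ℕ) :
    2 * Real.sin (φ / 2) * ∑ k ∈ Finset.range (n + 1), Real.sin (k * φ) =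
      Real.cos (φ / 2) - Real.cos (n * φ + φ / 2) := by
  induction n with
  | zero => simp
  | succ n ih =>
    rw [Finset.sum_range_succ, mul_add, ih]
    push_cast
    have e1 : (n : ℝ) * φ + φ / 2 = (n + 1) * φ - φ / 2 := by ring
    rw [e1, Real.cos_sub, Real.cos_add]
    ring

/-- When cos nθ = 0, the coefficients and sin 2kθ are even under k ↔ n-k. Subtracting the central
value c_M leaves two mirror copies of a convex sequence vanishing from M on; the constant part is
summed in closed form. -/
theorem sin_two_mul_mul_sum_nonneg_of_cos_eq_zero {l : ℝ} (hl : 0 < l) (hl1 : l ≤ 1) {n : ℕ}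
    (hn : Odd n) {θ : ℝ} (hθ : Real.cos (n * θ) = 0) :
    0 ≤ Real.sin (2 * θ) * ∑ k ∈ Finset.range (n + 1),
      binomCoeff l k * binomCoeff l (n - k) * Real.sin (2 * k * θ) := by
  obtain ⟨M, rfl⟩ := hn
  set n := 2 * M + 1 with hn
  have p : ∀ k, 0 < binomCoeff l k := binomCoeff_pos hl
  set c : ℕ → ℝ := fun k => binomCoeff l k * binomCoeff l (n - k) with hc
  set e : ℕ → ℝ := fun k => c (min k M) - c M with he
  have hanti : Antitone fun k => c (min k M) := by
    refine antitone_nat_of_succ_le fun k => ?_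
    by_cases h : k + 1 ≤ M
    · rw [min_eq_left h, min_eq_left (by omega)]
      have := binomCoeff_mul_le hl hl1 (show k ≤ n - (k + 1) by omega)
      rwa [show n - (k + 1) + 1 = n - k by omega] at this
    · rw [min_eq_right (by omega), min_eq_right (by omega)]
  have hzero : ∀ k, M ≤ k → e k = 0 := fun k hk => by
    simp only [he]; rw [min_eq_right hk, sub_self]
  have henn : ∀ k, 0 ≤ e k := by
    intro k
    have : c (min (max k M) M) ≤ c (min k M) := hanti (le_max_left k M)
    simp only [he]
    rw [min_eq_right (le_max_right k M)] at this
    linarith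
  have hconv : ∀ k, 0 ≤ e k - 2 * e (k + 1) + e (k + 2) := by
    intro k
    by_cases h : k + 2 ≤ M
    · obtain ⟨j, hj⟩ : ∃ j, n = k + 2 + j := ⟨n - (k + 2), by omega⟩
      have := binomCoeff_convex hl hl1 k j
      simp only [he, hc]
      rw [min_eq_left (by omega), min_eq_left (by omega), min_eq_left h,
        show n - k = j + 2 by omega, show n - (k + 1) = j + 1 by omega,
        show n - (k + 2) = j by omega]
      linarith
    · rw [hzero (k + 1) (by omega)]
      have := henn k
      have := henn (k + 2)
      linarith
  have hF := sin_mul_sum_nonneg (K := n + 1) (fun k hk => hzero k (by omega)) hconv (2 * θ)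
  have hsym : ∀ k ∈ Finset.range (n + 1), c k = c M + e k + e (n - k) := by
    intro k hk
    have hk' : k ≤ n := Nat.lt_succ_iff.1 (Finset.mem_range.1 hk)
    by_cases h : k ≤ M
    · rw [hzero (n - k) (by omega)]
      simp only [he]
      rw [min_eq_left h]; ring
    · rw [hzero k (by omega)]
      simp only [he]
      rw [min_eq_left (show n - k ≤ M by omega)]
      simp only [hc, Nat.sub_sub_self hk']
      ring
  have hsin : ∀ k ∈ Finset.range (n + 1),
      Real.sin (((n - k : ℕ) : ℝ) * (2 * θ)) = Real.sin (k * (2 * θ)) := by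
    intro k hk
    have hk' : k ≤ n := Nat.lt_succ_iff.1 (Finset.mem_range.1 hk)
    rw [Nat.cast_sub hk', show ((n : ℝ) - k) * (2 * θ) = 2 * (n * θ) - k * (2 * θ) by ring,
      Real.sin_sub, Real.sin_two_mul, Real.cos_two_mul, hθ]
    ring
  have hflip : ∑ k ∈ Finset.range (n + 1), e (n - k) * Real.sin (k * (2 * θ)) =
      ∑ k ∈ Finset.range (n + 1), e k * Real.sin (k * (2 * θ)) := by
    rw [← Finset.sum_flip (fun k => e k * Real.sin (k * (2 * θ)))]
    refine Finset.sum_congr rfl fun k hk => ?_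
    rw [hsin k hk]
  have hconst : 0 ≤ Real.sin (2 * θ) *
      ∑ k ∈ Finset.range (n + 1), Real.sin (k * (2 * θ)) := by
    have h := two_sin_mul_sum_sin (2 * θ) n
    rw [show 2 * θ / 2 = θ by ring, show (n : ℝ) * (2 * θ) + θ = 2 * (n * θ) + θ by ring,
      Real.cos_add, Real.cos_two_mul, Real.sin_two_mul, hθ] at h
    have h2 : Real.sin (2 * θ) * ∑ k ∈ Finset.range (n + 1), Real.sin (k * (2 * θ)) =
        2 * Real.cos θ ^ 2 := by
      rw [Real.sin_two_mul]
      linear_combination Real.cos θ * h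
    rw [h2]; positivity
  have hsum : ∑ k ∈ Finset.range (n + 1), c k * Real.sin (2 * k * θ) =
      c M * ∑ k ∈ Finset.range (n + 1), Real.sin (k * (2 * θ)) +
      2 * ∑ k ∈ Finset.range (n + 1), e k * Real.sin (k * (2 * θ)) := by
    have : ∀ k ∈ Finset.range (n + 1), c k * Real.sin (2 * k * θ) =
        c M * Real.sin (k * (2 * θ)) + e k * Real.sin (k * (2 * θ)) +
          e (n - k) * Real.sin (k * (2 * θ)) := fun k hk => by
      rw [hsym k hk, show 2 * (k : ℝ) * θ = k * (2 * θ) by ring]; ring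
    rw [Finset.sum_congr rfl this, Finset.sum_add_distrib, Finset.sum_add_distrib, hflip,
      ← Finset.mul_sum]
    ring
  rw [hsum]
  have hcM : 0 ≤ c M := (mul_pos (p _) (p _)).le
  have := mul_nonneg hcM hconst
  linarith

/-- At the zeros of the Chebyshev polynomial `U_n`. -/
theorem gegen_mul_eval_derivative_U_nonneg {l : ℝ} (hl : 1 < l) (hl2 : l ≤ 2) (n : ℕ) {x : ℝ}
    (hx : (Chebyshev.U ℝ n).eval x = 0) (hx1 : |x| < 1) :
    0 ≤ (gegen l n).eval x / (derivative (Chebyshev.U ℝ n)).eval x * x := by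
  obtain ⟨h1, h2⟩ := abs_lt.1 hx1
  set θ := Real.arccos x with hθ
  have hcos : Real.cos θ = x := Real.cos_arccos h1.le h2.le
  have hs : 0 < Real.sin θ := by
    rw [hθ, Real.sin_arccos]; exact Real.sqrt_pos.2 (by nlinarith)
  have hN : Real.sin (((n + 1 : ℕ) : ℝ) * θ) = 0 := by
    have := Chebyshev.U_real_cos θ n
    rw [hcos, hx, zero_mul] at this
    push_cast at this ⊢
    exact this.symm
  have hC : Real.cos (((n + 1 : ℕ) : ℝ) * θ) ^ 2 = 1 := by
    have := Real.sin_sq_add_cos_sq (((n + 1 : ℕ) : ℝ) * θ)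
    rw [hN] at this
    linarith
  have hd : ((n : ℝ) + 1) * Real.cos (((n + 1 : ℕ) : ℝ) * θ) =
      -Real.sin θ ^ 2 * (derivative (Chebyshev.U ℝ n)).eval x := by
    have h := congrArg (eval x) (Chebyshev.add_one_mul_T_eq_poly_in_U (R := ℝ) n)
    have hT := Chebyshev.T_real_cos θ (n + 1)
    rw [hcos] at hT
    simp only [eval_mul, eval_sub, eval_add, eval_X, eval_pow, eval_one, eval_intCast, hx] at h
    rw [hT] at h
    push_cast at h ⊢
    have hsc := Real.sin_sq_add_cos_sq θ
    rw [hcos] at hsc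
    linear_combination h + (derivative (Chebyshev.U ℝ n)).eval x * hsc
  have hsum := sin_two_mul_mul_sum_nonneg_of_sin_eq_zero (sub_pos.2 hl) (by linarith) (n + 1) hN
  have hg := gegen_add_one_eval_cos (l - 1) n θ
  rw [sub_add_cancel, hcos] at hg
  -- At a node sin Nθ = 0, so only -cos Nθ sin 2kθ survives in the addition formula. The same factor
  -- cos Nθ occurs in U_n'(x), so in the product it appears squared.
  have hg2 : 2 * (l - 1) * Real.sin θ * (gegen l n).eval x =
      -Real.cos (((n + 1 : ℕ) : ℝ) * θ) * ∑ k ∈ Finset.range (n + 1 + 1),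
      binomCoeff (l - 1) k * binomCoeff (l - 1) (n + 1 - k) *
        ((((n + 1 : ℕ) : ℝ) - 2 * k) * Real.sin (2 * k * θ)) := by
    rw [hg, Finset.mul_sum]
    refine Finset.sum_congr rfl fun k _ => ?_
    rw [sub_mul (((n + 1 : ℕ) : ℝ)) (2 * (k : ℝ)) θ, Real.sin_sub, hN]
    ring
  set S := ∑ k ∈ Finset.range (n + 1 + 1), binomCoeff (l - 1) k * binomCoeff (l - 1) (n + 1 - k) *
        ((((n + 1 : ℕ) : ℝ) - 2 * k) * Real.sin (2 * k * θ))
  set c := Real.cos (((n + 1 : ℕ) : ℝ) * θ)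
  set D := (derivative (Chebyshev.U ℝ n)).eval x
  set g := (gegen l n).eval x
  have hc0 : c ≠ 0 := fun h => by rw [h] at hC; norm_num at hC
  have hn : (0 : ℝ) < n + 1 := by positivity
  have hD : D ≠ 0 := by
    intro h
    rw [h, mul_zero] at hd
    exact mul_ne_zero hn.ne' hc0 hd
  rw [Real.sin_two_mul, hcos] at hsum
  have hgD : 0 ≤ g * D * x := by
    have e : (4 * (l - 1) * Real.sin θ ^ 4) * (g * D * x) =
        (n + 1) * c ^ 2 * (2 * Real.sin θ * x * S) := by
      linear_combination (2 * Real.sin θ ^ 3 * D * x) * hg2 - (2 * c * S * Real.sin θ * x) * hd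
    have : 0 ≤ (4 * (l - 1) * Real.sin θ ^ 4) * (g * D * x) := by rw [e]; positivity
    refine nonneg_of_mul_nonneg_right this ?_
    have := sub_pos.2 hl
    positivity
  have : g / D * x = g * D * x / D ^ 2 := by field_simp
  rw [this]; positivity

/-- At the zeros of the Chebyshev polynomial `T_n`, `n` odd. -/
theorem gegen_mul_eval_derivative_T_nonneg {l : ℝ} (hl : 0 < l) (hl1 : l ≤ 1) {n : ℕ}
    (hn : Odd n) {x : ℝ} (hx : (Chebyshev.T ℝ n).eval x = 0) (hx1 : |x| < 1) :
    0 ≤ (gegen l n).eval x / (derivative (Chebyshev.T ℝ n)).eval x * x := by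
  obtain ⟨h1, h2⟩ := abs_lt.1 hx1
  set θ := Real.arccos x with hθ
  have hcos : Real.cos θ = x := Real.cos_arccos h1.le h2.le
  have hs : 0 < Real.sin θ := by
    rw [hθ, Real.sin_arccos]; exact Real.sqrt_pos.2 (by nlinarith)
  have hN : Real.cos (n * θ) = 0 := by
    have := Chebyshev.T_real_cos θ n
    rw [hcos, hx] at this
    exact_mod_cast this.symm
  have hC : Real.sin (n * θ) ^ 2 = 1 := by
    have := Real.sin_sq_add_cos_sq (n * θ)
    rw [hN] at this
    linarith
  have hd : (derivative (Chebyshev.T ℝ n)).eval x * Real.sin θ = n * Real.sin (n * θ) := by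
    rw [Chebyshev.T_derivative_eq_U]
    have hU := Chebyshev.U_real_cos θ ((n : ℤ) - 1)
    rw [hcos] at hU
    push_cast at hU
    rw [sub_add_cancel] at hU
    rw [eval_mul, mul_assoc, hU]
    simp
  have hsum := sin_two_mul_mul_sum_nonneg_of_cos_eq_zero hl hl1 hn hN
  have hg := gegen_eval_cos l n θ
  rw [hcos] at hg
  have hg2 : (gegen l n).eval x = Real.sin (n * θ) * ∑ k ∈ Finset.range (n + 1),
      binomCoeff l k * binomCoeff l (n - k) * Real.sin (2 * k * θ) := by
    rw [hg, Finset.mul_sum]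
    refine Finset.sum_congr rfl fun k _ => ?_
    rw [sub_mul (n : ℝ) (2 * (k : ℝ)) θ, Real.cos_sub, hN]
    ring
  set S := ∑ k ∈ Finset.range (n + 1),
      binomCoeff l k * binomCoeff l (n - k) * Real.sin (2 * k * θ)
  set s := Real.sin (n * θ)
  set D := (derivative (Chebyshev.T ℝ n)).eval x
  set g := (gegen l n).eval x
  have hs0 : s ≠ 0 := fun h => by rw [h] at hC; norm_num at hC
  have hn0 : (0 : ℝ) < n := by exact_mod_cast hn.pos
  have hD : D ≠ 0 := by
    intro h
    rw [h, zero_mul] at hd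
    exact mul_ne_zero hn0.ne' hs0 hd.symm
  rw [Real.sin_two_mul, hcos] at hsum
  have hgD : 0 ≤ g * D * x := by
    have e : (2 * Real.sin θ ^ 2) * (g * D * x) = n * s ^ 2 * (2 * Real.sin θ * x * S) := by
      linear_combination (2 * Real.sin θ ^ 2 * D * x) * hg2 + (2 * s * S * Real.sin θ * x) * hd
    have : 0 ≤ (2 * Real.sin θ ^ 2) * (g * D * x) := by rw [e]; positivity
    exact nonneg_of_mul_nonneg_right this (by positivity)
  have : g / D * x = g * D * x / D ^ 2 := by field_simp
  rw [this]; positivity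

/-! ### The threshold ρ₂*. -/

theorem rhoTwoStar_mul : rhoTwoStar * ((Real.sqrt 6 - Real.sqrt 2) / 2) = 1 := by
  have h2 : Real.sqrt 2 ^ 2 = 2 := Real.sq_sqrt (by norm_num)
  have h6 : Real.sqrt 6 ^ 2 = 6 := Real.sq_sqrt (by norm_num)
  rw [rhoTwoStar]
  linear_combination (h6 - h2) / 4

theorem one_lt_rhoTwoStar : 1 < rhoTwoStar := by
  have h2 : 1 < Real.sqrt 2 := by rw [Real.lt_sqrt] <;> norm_num
  have h6 : 1 < Real.sqrt 6 := by rw [Real.lt_sqrt] <;> norm_num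
  rw [rhoTwoStar]; linarith

theorem rhoTwoStar_inv : rhoTwoStar⁻¹ = (Real.sqrt 6 - Real.sqrt 2) / 2 :=
  inv_eq_of_mul_eq_one_right rhoTwoStar_mul

theorem rhoTwoStar_add_inv : rhoTwoStar + rhoTwoStar⁻¹ = Real.sqrt 6 := by
  rw [rhoTwoStar_inv, rhoTwoStar]; ring

/-- The expression factors as a₁((ρ+ρ⁻¹)² - 6), and ρ₂* + 1/ρ₂* = √6; the other solution 1/ρ₂* is
below 1. -/
theorem ellipseA_three_sub_eq_zero_iff {ρ : ℝ} (hρ : 1 < ρ) :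
    ellipseA 3 ρ - 3 * ellipseA 1 ρ = 0 ↔ ρ = rhoTwoStar := by
  have hρ0 : 0 < ρ := by linarith
  have hinv : ρ * ρ⁻¹ = 1 := mul_inv_cancel₀ hρ0.ne'
  have hi0 : 0 < ρ⁻¹ := by positivity
  have h6 : Real.sqrt 6 ^ 2 = 6 := Real.sq_sqrt (by norm_num)
  have h60 : 0 < Real.sqrt 6 := by positivity
  have e : ellipseA 3 ρ - 3 * ellipseA 1 ρ =
      (ρ + ρ⁻¹) / 2 * ((ρ + ρ⁻¹ + Real.sqrt 6) * (ρ + ρ⁻¹ - Real.sqrt 6)) := by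
    simp only [ellipseA, ← inv_pow]
    linear_combination (ρ + ρ⁻¹) / 2 * h6 - 3 * (ρ + ρ⁻¹) / 2 * hinv
  rw [e]
  constructor
  · intro h
    have h1 : (ρ + ρ⁻¹) / 2 ≠ 0 := by positivity
    have h2 : ρ + ρ⁻¹ + Real.sqrt 6 ≠ 0 := by positivity
    have hs : ρ + ρ⁻¹ - Real.sqrt 6 = 0 := by
      rcases mul_eq_zero.1 h with h | h
      · exact absurd h h1
      · exact (mul_eq_zero.1 h).resolve_left h2
    rw [← rhoTwoStar_add_inv] at hs
    have hr : rhoTwoStar * rhoTwoStar⁻¹ = 1 :=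
      mul_inv_cancel₀ (by linarith [one_lt_rhoTwoStar])
    have hprod : (ρ - rhoTwoStar) * (ρ - rhoTwoStar⁻¹) = 0 := by
      linear_combination ρ * hs - hinv + hr
    rcases mul_eq_zero.1 hprod with h | h
    · linarith
    · have := inv_lt_one_of_one_lt₀ one_lt_rhoTwoStar
      linarith
  · rintro rfl
    rw [rhoTwoStar_add_inv, sub_self, mul_zero, mul_zero]

theorem six_le_of_rhoTwoStar_le {ρ : ℝ} (hρ : rhoTwoStar ≤ ρ) : 6 ≤ (ρ + ρ⁻¹) ^ 2 := by
  have hr1 := one_lt_rhoTwoStar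
  have hρ0 : 0 < ρ := by linarith
  have h6 : Real.sqrt 6 ^ 2 = 6 := Real.sq_sqrt (by norm_num)
  have h : rhoTwoStar + rhoTwoStar⁻¹ ≤ ρ + ρ⁻¹ := by
    have hinv : ρ * ρ⁻¹ = 1 := mul_inv_cancel₀ hρ0.ne'
    have hr : rhoTwoStar * rhoTwoStar⁻¹ = 1 := mul_inv_cancel₀ (by linarith)
    have e : ρ + ρ⁻¹ - (rhoTwoStar + rhoTwoStar⁻¹) =
        (ρ - rhoTwoStar) * (1 - ρ⁻¹ * rhoTwoStar⁻¹) := by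
      linear_combination rhoTwoStar⁻¹ * hinv - ρ⁻¹ * hr
    have h1 : ρ⁻¹ ≤ 1 := inv_le_one_of_one_le₀ (by linarith)
    have h2 : rhoTwoStar⁻¹ ≤ 1 := inv_le_one_of_one_le₀ hr1.le
    have h3 : ρ⁻¹ * rhoTwoStar⁻¹ ≤ 1 := mul_le_one₀ h1 (by positivity) h2
    have := mul_nonneg (sub_nonneg.2 hρ) (sub_nonneg.2 h3)
    linarith
  rw [rhoTwoStar_add_inv] at h
  rw [← h6]
  gcongr

/-! ### The ellipse in polar form and the Chebyshev base cases. -/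

theorem minorAxisEndpoint_eq (ρ : ℝ) :
    minorAxisEndpoint ρ = Complex.I * (((ρ - ρ⁻¹) / 2 : ℝ) : ℂ) := by
  rw [minorAxisEndpoint]; push_cast; ring

theorem minorAxisEndpoint_eq_polar (ρ : ℝ) : minorAxisEndpoint ρ =
    ((ρ : ℂ) * Complex.exp (Complex.I * ((Real.pi / 2 : ℝ) : ℂ)) +
      ((ρ : ℂ) * Complex.exp (Complex.I * ((Real.pi / 2 : ℝ) : ℂ)))⁻¹) / 2 := by
  have h : Complex.exp (Complex.I * ((Real.pi / 2 : ℝ) : ℂ)) = Complex.I := by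
    rw [mul_comm]; push_cast; exact Complex.exp_pi_div_two_mul_I
  rw [h, mul_inv, Complex.inv_I, minorAxisEndpoint]; ring

theorem minorAxisEndpoint_mem (ρ : ℝ) : minorAxisEndpoint ρ ∈ bernsteinEllipse ρ :=
  ⟨Real.pi / 2, by positivity, by linarith [Real.pi_pos], _, rfl, minorAxisEndpoint_eq_polar ρ⟩

theorem neg_minorAxisEndpoint_mem (ρ : ℝ) : -minorAxisEndpoint ρ ∈ bernsteinEllipse ρ := by
  refine ⟨3 * Real.pi / 2, by positivity, by linarith [Real.pi_pos], _, rfl, ?_⟩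
  have h : Complex.exp (Complex.I * ((3 * Real.pi / 2 : ℝ) : ℂ)) = -Complex.I := by
    have : Complex.I * ((3 * Real.pi / 2 : ℝ) : ℂ) =
        Real.pi * Complex.I + Real.pi / 2 * Complex.I := by push_cast; ring
    rw [this, Complex.exp_add, Complex.exp_pi_mul_I, Complex.exp_pi_div_two_mul_I]; ring
  rw [h, mul_inv, inv_neg, Complex.inv_I, minorAxisEndpoint]; ring

theorem polar_pow {ρ : ℝ} (θ : ℝ) (k : ℕ) :
    ((ρ : ℂ) * Complex.exp (Complex.I * (θ : ℂ))) ^ k =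
      ⟨ρ ^ k * Real.cos (k * θ), ρ ^ k * Real.sin (k * θ)⟩ := by
  rw [mul_pow, ← Complex.exp_nat_mul,
    show (k : ℂ) * (Complex.I * θ) = ((k * θ : ℝ) : ℂ) * Complex.I by push_cast; ring,
    ← Complex.ofReal_pow]
  apply Complex.ext
  · rw [Complex.re_ofReal_mul, Complex.exp_ofReal_mul_I_re]
  · rw [Complex.im_ofReal_mul, Complex.exp_ofReal_mul_I_im]

theorem polar_inv_pow {ρ : ℝ} (θ : ℝ) (k : ℕ) :
    ((ρ : ℂ) * Complex.exp (Complex.I * (θ : ℂ)))⁻¹ ^ k =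
      ⟨ρ⁻¹ ^ k * Real.cos (k * θ), -(ρ⁻¹ ^ k * Real.sin (k * θ))⟩ := by
  have h : ((ρ : ℂ) * Complex.exp (Complex.I * (θ : ℂ)))⁻¹ =
      ((ρ⁻¹ : ℝ) : ℂ) * Complex.exp (Complex.I * ((-θ : ℝ) : ℂ)) := by
    rw [mul_inv, ← Complex.exp_neg]; push_cast; rw [mul_neg]
  rw [h, polar_pow, mul_neg, Real.cos_neg, Real.sin_neg, mul_neg]

theorem normSq_polar_sub {ρ : ℝ} (hρ : 0 < ρ) (θ : ℝ) (k : ℕ) :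
    Complex.normSq (((ρ : ℂ) * Complex.exp (Complex.I * (θ : ℂ))) ^ k -
      ((ρ : ℂ) * Complex.exp (Complex.I * (θ : ℂ)))⁻¹ ^ k) =
      (ρ ^ k - ρ⁻¹ ^ k) ^ 2 + 4 * Real.sin (k * θ) ^ 2 := by
  have h1 : ρ ^ k * ρ⁻¹ ^ k = 1 := by rw [← mul_pow, mul_inv_cancel₀ hρ.ne', one_pow]
  rw [polar_pow, polar_inv_pow, Complex.normSq_apply]
  simp only [Complex.sub_re, Complex.sub_im]
  have := Real.sin_sq_add_cos_sq (k * θ)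
  linear_combination 4 * Real.sin (k * θ) ^ 2 * h1 + (ρ ^ k - ρ⁻¹ ^ k) ^ 2 * this

theorem normSq_polar_add {ρ : ℝ} (hρ : 0 < ρ) (θ : ℝ) (k : ℕ) :
    Complex.normSq (((ρ : ℂ) * Complex.exp (Complex.I * (θ : ℂ))) ^ k +
      ((ρ : ℂ) * Complex.exp (Complex.I * (θ : ℂ)))⁻¹ ^ k) =
      (ρ ^ k - ρ⁻¹ ^ k) ^ 2 + 4 * Real.cos (k * θ) ^ 2 := by
  have h1 : ρ ^ k * ρ⁻¹ ^ k = 1 := by rw [← mul_pow, mul_inv_cancel₀ hρ.ne', one_pow]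
  rw [polar_pow, polar_inv_pow, Complex.normSq_apply]
  simp only [Complex.add_re, Complex.add_im]
  have := Real.sin_sq_add_cos_sq (k * θ)
  linear_combination 4 * Real.cos (k * θ) ^ 2 * h1 + (ρ ^ k - ρ⁻¹ ^ k) ^ 2 * this

theorem aeval_T_joukowski (n : ℕ) {u : ℂ} (hu : u ≠ 0) :
    aeval ((u + u⁻¹) / 2) (Chebyshev.T ℝ n) = (u ^ n + u⁻¹ ^ n) / 2 := by
  induction n using Nat.strong_induction_on with
  | _ n ih =>
    match n with
    | 0 => simp
    | 1 => simp
    | n + 2 =>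
      have h1 := ih (n + 1) (by omega)
      have h0 := ih n (by omega)
      push_cast at h1 h0 ⊢
      rw [Chebyshev.T_add_two, map_sub, map_mul, map_mul, h1, h0, aeval_X, map_ofNat]
      have := mul_inv_cancel₀ hu
      linear_combination (u ^ n / 2 + u⁻¹ ^ n / 2) * this

theorem aeval_U_joukowski (n : ℕ) {u : ℂ} (hu : u ≠ 0) :
    aeval ((u + u⁻¹) / 2) (Chebyshev.U ℝ n) * (u - u⁻¹) = u ^ (n + 1) - u⁻¹ ^ (n + 1) := by
  induction n using Nat.strong_induction_on with
  | _ n ih =>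
    match n with
    | 0 => simp
    | 1 => simp [map_ofNat]; ring
    | n + 2 =>
      have h1 := ih (n + 1) (by omega)
      have h0 := ih n (by omega)
      push_cast at h1 h0 ⊢
      rw [Chebyshev.U_add_two, map_sub, map_mul, map_mul, aeval_X, map_ofNat]
      have := mul_inv_cancel₀ hu
      linear_combination (u + u⁻¹) * h1 - h0 + (u ^ (n + 1) - u⁻¹ ^ (n + 1)) * this

theorem aeval_neg_T (n : ℕ) (z : ℂ) :
    aeval (-z) (Chebyshev.T ℝ n) = (-1) ^ n * aeval z (Chebyshev.T ℝ n) := by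
  induction n using Nat.strong_induction_on with
  | _ n ih =>
    match n with
    | 0 => simp
    | 1 => simp
    | n + 2 =>
      have h1 := ih (n + 1) (by omega)
      have h0 := ih n (by omega)
      push_cast at h1 h0 ⊢
      simp only [Chebyshev.T_add_two, map_sub, map_mul, aeval_X, map_ofNat, h1, h0]
      ring

/-- On the Bernstein ellipse, the modulus of `p` is at least its value at the endpoint of the minor
axis. -/
def MinAtMinorAxis (ρ : ℝ) (p : ℝ[X]) : Prop :=
  ∀ z ∈ bernsteinEllipse ρ, ‖aeval (minorAxisEndpoint ρ) p‖ ≤ ‖aeval z p‖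

theorem cos_odd_mul_pi_div_two {n : ℕ} (hn : Odd n) : Real.cos (n * (Real.pi / 2)) = 0 := by
  obtain ⟨M, rfl⟩ := hn
  rw [Real.cos_eq_zero_iff]
  exact ⟨M, by push_cast; ring⟩

/-- Here 4|T_n|² = (ρⁿ-ρ⁻ⁿ)² + 4cos² nθ, and for odd n the cosine vanishes at θ = π/2. -/
theorem minAtMinorAxis_T {ρ : ℝ} (hρ : 0 < ρ) {n : ℕ} (hn : Odd n) :
    MinAtMinorAxis ρ (Chebyshev.T ℝ n) := by
  rintro z ⟨θ, -, -, u, rfl, rfl⟩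
  have hne : ∀ θ : ℝ, (ρ : ℂ) * Complex.exp (Complex.I * (θ : ℂ)) ≠ 0 := fun θ =>
    mul_ne_zero (by exact_mod_cast hρ.ne') (Complex.exp_ne_zero _)
  rw [minorAxisEndpoint_eq_polar, aeval_T_joukowski n (hne _), aeval_T_joukowski n (hne _),
    norm_div, norm_div]
  gcongr
  rw [← sq_le_sq₀ (norm_nonneg _) (norm_nonneg _), Complex.sq_norm, Complex.sq_norm,
    normSq_polar_add hρ, normSq_polar_add hρ, cos_odd_mul_pi_div_two hn]
  nlinarith [sq_nonneg (Real.cos (n * θ))]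

/-- The bound on increments is carried along to drive the induction. Its first instance is a₃ ≥ 3a₁,
the threshold condition. -/
theorem odd_mul_le_pow_add {ρ : ℝ} (hρ : 0 < ρ) (h6 : 6 ≤ (ρ + ρ⁻¹) ^ 2) (M : ℕ) :
    (2 * M + 1) * (ρ + ρ⁻¹) ≤ ρ ^ (2 * M + 1) + ρ⁻¹ ^ (2 * M + 1) ∧
      2 * (ρ + ρ⁻¹) ≤ ρ ^ (2 * M + 3) + ρ⁻¹ ^ (2 * M + 3) -
        (ρ ^ (2 * M + 1) + ρ⁻¹ ^ (2 * M + 1)) := by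
  have h1 : ρ * ρ⁻¹ = 1 := mul_inv_cancel₀ hρ.ne'
  have hi : 0 < ρ⁻¹ := by positivity
  induction M with
  | zero =>
    constructor
    · simp
    · have e : ρ ^ (2 * 0 + 3) + ρ⁻¹ ^ (2 * 0 + 3) - (ρ ^ (2 * 0 + 1) + ρ⁻¹ ^ (2 * 0 + 1)) =
          ((ρ + ρ⁻¹) ^ 2 - 4) * (ρ + ρ⁻¹) := by
        norm_num
        linear_combination -3 * (ρ + ρ⁻¹) * h1
      rw [e]
      gcongr
      linarith
  | succ M ih =>
    obtain ⟨i1, i2⟩ := ih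
    have e : ρ ^ (2 * (M + 1) + 3) + ρ⁻¹ ^ (2 * (M + 1) + 3) =
        ((ρ + ρ⁻¹) ^ 2 - 2) * (ρ ^ (2 * M + 3) + ρ⁻¹ ^ (2 * M + 3)) -
          (ρ ^ (2 * M + 1) + ρ⁻¹ ^ (2 * M + 1)) := by
      linear_combination (-2 * (ρ ^ (2 * M + 3) + ρ⁻¹ ^ (2 * M + 3)) -
        (ρ * ρ⁻¹ + 1) * (ρ ^ (2 * M + 1) + ρ⁻¹ ^ (2 * M + 1))) * h1
    constructor
    · push_cast
      rw [show 2 * (M + 1) + 1 = 2 * M + 3 by ring]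
      linarith
    · rw [e, show 2 * (M + 1) + 1 = 2 * M + 3 by ring]
      have : 0 < ρ ^ (2 * M + 3) + ρ⁻¹ ^ (2 * M + 3) := by positivity
      nlinarith

/-- Put N = n+1. For N even, θ = π/2 minimizes the numerator and maximizes the denominator of
|U_n|². For N odd the claim reduces to (ρ+ρ⁻¹)² cos² Nθ ≤ (ρᴺ+ρ⁻ᴺ)² cos² θ, which follows from |cos
Nθ| ≤ N|cos θ| and `odd_mul_le_pow_add`. -/
theorem minAtMinorAxis_U {ρ : ℝ} (hρ : rhoTwoStar ≤ ρ) (n : ℕ) :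
    MinAtMinorAxis ρ (Chebyshev.U ℝ n) := by
  rintro z ⟨θ, -, -, u, rfl, rfl⟩
  have hρ1 : 1 < ρ := one_lt_rhoTwoStar.trans_le hρ
  have hρ0 : 0 < ρ := by linarith
  have h6 := six_le_of_rhoTwoStar_le hρ
  have hne : ∀ θ : ℝ, (ρ : ℂ) * Complex.exp (Complex.I * (θ : ℂ)) ≠ 0 := fun θ =>
    mul_ne_zero (by exact_mod_cast hρ0.ne') (Complex.exp_ne_zero _)
  have key : ∀ θ : ℝ, ‖aeval (((ρ : ℂ) * Complex.exp (Complex.I * (θ : ℂ)) +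
      ((ρ : ℂ) * Complex.exp (Complex.I * (θ : ℂ)))⁻¹) / 2) (Chebyshev.U ℝ n)‖ ^ 2 *
      ((ρ - ρ⁻¹) ^ 2 + 4 * Real.sin θ ^ 2) =
      (ρ ^ (n + 1) - ρ⁻¹ ^ (n + 1)) ^ 2 + 4 * Real.sin (((n + 1 : ℕ) : ℝ) * θ) ^ 2 := by
    intro θ
    have h := congrArg Complex.normSq (aeval_U_joukowski n (hne θ))
    have h1 := normSq_polar_sub hρ0 θ 1
    rw [pow_one, pow_one, pow_one, pow_one, Nat.cast_one, one_mul] at h1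
    rwa [map_mul, normSq_polar_sub hρ0, h1, ← Complex.sq_norm] at h
  have k0 := key (Real.pi / 2)
  have k1 := key θ
  rw [← minorAxisEndpoint_eq_polar, Real.sin_pi_div_two] at k0
  set x0 := ‖aeval (minorAxisEndpoint ρ) (Chebyshev.U ℝ n)‖
  set x1 := ‖aeval (((ρ : ℂ) * Complex.exp (Complex.I * (θ : ℂ)) +
      ((ρ : ℂ) * Complex.exp (Complex.I * (θ : ℂ)))⁻¹) / 2) (Chebyshev.U ℝ n)‖
  have hinv : ρ⁻¹ < 1 := inv_lt_one_of_one_lt₀ hρ1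
  have hv : 0 < (ρ - ρ⁻¹) ^ 2 := by
    have : 0 < ρ - ρ⁻¹ := by linarith
    positivity
  have p0 : 0 < (ρ - ρ⁻¹) ^ 2 + 4 * (1 : ℝ) ^ 2 := by positivity
  have p1 : 0 < (ρ - ρ⁻¹) ^ 2 + 4 * Real.sin θ ^ 2 := by positivity
  rw [← sq_le_sq₀ (norm_nonneg _) (norm_nonneg _)]
  suffices h : x0 ^ 2 * ((ρ - ρ⁻¹) ^ 2 + 4 * (1 : ℝ) ^ 2) * ((ρ - ρ⁻¹) ^ 2 + 4 * Real.sin θ ^ 2) ≤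
      x1 ^ 2 * ((ρ - ρ⁻¹) ^ 2 + 4 * Real.sin θ ^ 2) * ((ρ - ρ⁻¹) ^ 2 + 4 * (1 : ℝ) ^ 2) by
    rw [mul_right_comm (x1 ^ 2), mul_assoc (x0 ^ 2), mul_assoc (x1 ^ 2)] at h
    exact le_of_mul_le_mul_right h (mul_pos p0 p1)
  rw [k0, k1]
  have hsc := Real.sin_sq_add_cos_sq θ
  rcases Nat.even_or_odd (n + 1) with hN | hN
  · have hs : Real.sin (((n + 1 : ℕ) : ℝ) * (Real.pi / 2)) = 0 := by
      obtain ⟨M, hM⟩ := hN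
      rw [hM, show ((M + M : ℕ) : ℝ) * (Real.pi / 2) = M * Real.pi by push_cast; ring]
      exact Real.sin_nat_mul_pi M
    rw [hs]
    refine mul_le_mul ?_ ?_ (by positivity) (by positivity)
    · linarith [sq_nonneg (Real.sin (((n + 1 : ℕ) : ℝ) * θ))]
    · linarith [sq_nonneg (Real.cos θ)]
  · have hc := cos_odd_mul_pi_div_two hN
    have hs : Real.sin (((n + 1 : ℕ) : ℝ) * (Real.pi / 2)) ^ 2 = 1 := by
      have := Real.sin_sq_add_cos_sq (((n + 1 : ℕ) : ℝ) * (Real.pi / 2))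
      rw [hc] at this
      linarith
    have hcos : Real.cos (((n + 1 : ℕ) : ℝ) * θ) ^ 2 ≤
        ((n + 1 : ℕ) : ℝ) ^ 2 * Real.cos θ ^ 2 := by
      have h := abs_sin_nat_mul_le (n + 1) (Real.pi / 2 - θ)
      rw [Real.sin_pi_div_two_sub] at h
      have h2 := pow_le_pow_left₀ (abs_nonneg _) h 2
      rw [mul_pow, sq_abs, sq_abs, mul_sub, Real.sin_sub, hc, zero_mul, sub_zero, mul_pow, hs,
        one_mul] at h2
      exact h2
    have hw : (((n + 1 : ℕ) : ℝ) * (ρ + ρ⁻¹)) ^ 2 ≤ (ρ ^ (n + 1) + ρ⁻¹ ^ (n + 1)) ^ 2 := by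
      obtain ⟨M, hM⟩ := hN
      have := (odd_mul_le_pow_add hρ0 h6 M).1
      rw [hM]
      push_cast
      gcongr
    have hw1 : (ρ - ρ⁻¹) ^ 2 = (ρ + ρ⁻¹) ^ 2 - 4 := by
      linear_combination -4 * mul_inv_cancel₀ hρ0.ne'
    have hwN : (ρ ^ (n + 1) - ρ⁻¹ ^ (n + 1)) ^ 2 = (ρ ^ (n + 1) + ρ⁻¹ ^ (n + 1)) ^ 2 - 4 := by
      have : ρ ^ (n + 1) * ρ⁻¹ ^ (n + 1) = 1 := by
        rw [← mul_pow, mul_inv_cancel₀ hρ0.ne', one_pow]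
      linear_combination -4 * this
    have hscN := Real.sin_sq_add_cos_sq (((n + 1 : ℕ) : ℝ) * θ)
    rw [hs, hw1, hwN]
    set W := (ρ ^ (n + 1) + ρ⁻¹ ^ (n + 1)) ^ 2
    set w := (ρ + ρ⁻¹) ^ 2 with hw_def
    have m1 : Real.cos (((n + 1 : ℕ) : ℝ) * θ) ^ 2 * w ≤
        ((n + 1 : ℕ) : ℝ) ^ 2 * Real.cos θ ^ 2 * w := by gcongr
    have m2 : (((n + 1 : ℕ) : ℝ) * (ρ + ρ⁻¹)) ^ 2 * Real.cos θ ^ 2 ≤ W * Real.cos θ ^ 2 := by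
      gcongr
    rw [mul_pow, ← hw_def] at m2
    have s1 : Real.sin θ ^ 2 = 1 - Real.cos θ ^ 2 := by linarith
    have s2 : Real.sin (((n + 1 : ℕ) : ℝ) * θ) ^ 2 =
      1 - Real.cos (((n + 1 : ℕ) : ℝ) * θ) ^ 2 := by linarith
    rw [s1, s2]
    linarith

/-! ### Partial fractions and transfer of minimality. -/

/-- On the ellipse, `Re (z² - x²)⁻¹` for `x ∈ [-1, 1]` is smallest at the ends of the minor
axis. -/
theorem re_inv_sq_sub_sq_ge {ρ : ℝ} (hρ : rhoTwoStar ≤ ρ) {z : ℂ} (hz : z ∈ bernsteinEllipse ρ)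
    {x : ℝ} (hx : |x| ≤ 1) :
    z ^ 2 - (x : ℂ) ^ 2 ≠ 0 ∧
      -(((ρ - ρ⁻¹) / 2) ^ 2 + x ^ 2)⁻¹ ≤ ((z ^ 2 - (x : ℂ) ^ 2)⁻¹).re := by
  obtain ⟨θ, -, -, u, rfl, rfl⟩ := hz
  have hρ0 : 0 < ρ := by linarith [one_lt_rhoTwoStar]
  have h6 := six_le_of_rhoTwoStar_le hρ
  have hinv : ρ * ρ⁻¹ = 1 := mul_inv_cancel₀ hρ0.ne'
  set a : ℝ := (ρ ^ 2 + ρ⁻¹ ^ 2) / 2 with ha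
  set d : ℝ := (ρ ^ 2 - ρ⁻¹ ^ 2) / 2 with hd
  set t := Real.cos (2 * θ)
  set s := Real.sin (2 * θ)
  have hts : s ^ 2 + t ^ 2 = 1 := Real.sin_sq_add_cos_sq _
  have ha2 : 2 ≤ a := by nlinarith
  have had : a ^ 2 - d ^ 2 = 1 := by
    rw [ha, hd]; linear_combination (ρ * ρ⁻¹ + 1) * hinv
  set c : ℝ := 2 * x ^ 2 - 1 with hc
  have hx2 : x ^ 2 ≤ 1 := by rw [← sq_abs]; exact pow_le_one₀ (abs_nonneg _) hx
  have hc1 : c ≤ 1 := by rw [hc]; linarith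
  have hcm : -1 ≤ c := by rw [hc]; linarith [sq_nonneg x]
  have ht1 : t ≤ 1 := Real.cos_le_one _
  have htm : -1 ≤ t := Real.neg_one_le_cos _
  set u := (ρ : ℂ) * Complex.exp (Complex.I * (θ : ℂ)) with hu
  have hu0 : u ≠ 0 := mul_ne_zero (by exact_mod_cast hρ0.ne') (Complex.exp_ne_zero _)
  have hw : ((u + u⁻¹) / 2) ^ 2 - (x : ℂ) ^ 2 = ⟨(a * t - c) / 2, d * s / 2⟩ := by
    have h1 : ((u + u⁻¹) / 2) ^ 2 - (x : ℂ) ^ 2 =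
        (u ^ 2 + u⁻¹ ^ 2) / 4 + ((1 / 2 - x ^ 2 : ℝ) : ℂ) := by
      push_cast
      linear_combination (1 / 2 : ℂ) * mul_inv_cancel₀ hu0
    rw [h1, hu, polar_pow, polar_inv_pow]
    simp only [Nat.cast_ofNat]
    apply Complex.ext
    · rw [Complex.add_re, Complex.ofReal_re]
      rw [show (4 : ℂ) = ((4 : ℝ) : ℂ) by norm_num, Complex.div_ofReal_re, Complex.add_re]
      simp only [ha, hc]; ring
    · rw [Complex.add_im, Complex.ofReal_im]
      rw [show (4 : ℂ) = ((4 : ℝ) : ℂ) by norm_num, Complex.div_ofReal_im, Complex.add_im]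
      simp only [hd]; ring
  rw [hw]
  have hnorm : Complex.normSq ⟨(a * t - c) / 2, d * s / 2⟩ =
      ((a * t - c) ^ 2 + (a ^ 2 - 1) * (1 - t ^ 2)) / 4 := by
    rw [Complex.normSq_mk]
    linear_combination (-s ^ 2 / 4) * had + (a ^ 2 - 1) / 4 * hts
  have hct : c * t ≤ 1 := by nlinarith
  -- The left side of the sum equals (c-t)² + (a-1)(a+1-2ct).
  have hpos : 0 < (a * t - c) ^ 2 + (a ^ 2 - 1) * (1 - t ^ 2) := by
    have h1 : 0 < (a - 1) * (a + 1 - 2 * (c * t)) := mul_pos (by linarith) (by linarith)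
    nlinarith [sq_nonneg (c - t)]
  refine ⟨fun h => ?_, ?_⟩
  · rw [← Complex.normSq_eq_zero, hnorm] at h
    linarith
  · rw [Complex.inv_re, hnorm]
    have hb : ((ρ - ρ⁻¹) / 2) ^ 2 + x ^ 2 = (a + c) / 2 := by
      rw [ha, hc]; linear_combination (-1 / 2) * hinv
    rw [hb]
    have hac : 0 < a + c := by linarith
    -- This is the claim with denominators cleared. It vanishes at t = -1, the minor axis; the
    -- second factor is smallest at c = 1, t = -1, where it is (a-2)(a+1), so a ≥ 2 is what is
    -- needed.
    have hcase : 0 ≤ (1 + t) * (a ^ 2 - 1 + t - a * c) := by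
      apply mul_nonneg (by linarith)
      nlinarith
    rw [neg_le_iff_add_nonneg, inv_eq_one_div, div_add_div _ _ (by linarith) (by linarith)]
    apply div_nonneg _ (by positivity)
    nlinarith

/-- If `Q / P` is a constant plus nonnegative multiples of `1 / (z² - x²)` with `x ∈ [-1, 1]`, then
the minimality at the minor axis passes from `P` to `Q`. -/
theorem MinAtMinorAxis.of_partial_fractions {ρ : ℝ} (hρ : rhoTwoStar ≤ ρ) {P Q : ℝ[X]}
    (hP : MinAtMinorAxis ρ P) {ι : Type*} (S : Finset ι) (A : ℝ) (m x : ι → ℝ)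
    (hm : ∀ i ∈ S, 0 ≤ m i) (hx : ∀ i ∈ S, |x i| ≤ 1)
    (hQ : ∀ z : ℂ, (∀ i ∈ S, z ^ 2 - (x i : ℂ) ^ 2 ≠ 0) → aeval z Q =
      aeval z P * (A + ∑ i ∈ S, (m i : ℂ) * (z ^ 2 - (x i : ℂ) ^ 2)⁻¹))
    (hpos : ∃ r : ℝ, 0 ≤ r ∧ aeval (minorAxisEndpoint ρ) Q = r * aeval (minorAxisEndpoint ρ) P)
    (hP0 : aeval (minorAxisEndpoint ρ) P ≠ 0) :
    MinAtMinorAxis ρ Q := by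
  intro z hz
  obtain ⟨r, hr, hQr⟩ := hpos
  have hend := minorAxisEndpoint_mem ρ
  have hQe := hQ _ fun i hi => (re_inv_sq_sub_sq_ge hρ hend (hx i hi)).1
  have hQz := hQ z fun i hi => (re_inv_sq_sub_sq_ge hρ hz (hx i hi)).1
  -- At the endpoint z² is real and negative, so the partial fraction sum is the real number r. The
  -- sign of A is not known, so r ≥ 0 is a separate hypothesis.
  have hr2 : r = A + ∑ i ∈ S, m i * -(((ρ - ρ⁻¹) / 2) ^ 2 + x i ^ 2)⁻¹ := by
    have h : (r : ℂ) = A + ∑ i ∈ S, (m i : ℂ) *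
        ((minorAxisEndpoint ρ) ^ 2 - (x i : ℂ) ^ 2)⁻¹ := by
      apply mul_left_cancel₀ hP0
      rw [← hQe, hQr, mul_comm]
    have h2 : ∀ i, ((minorAxisEndpoint ρ) ^ 2 - (x i : ℂ) ^ 2)⁻¹ =
        ((-(((ρ - ρ⁻¹) / 2) ^ 2 + x i ^ 2)⁻¹ : ℝ) : ℂ) := by
      intro i
      rw [minorAxisEndpoint_eq, mul_pow, Complex.I_sq, ← inv_neg]
      push_cast
      congr 1
      ring
    simp only [h2] at h
    exact_mod_cast h
  rw [hQr, hQz, norm_mul, norm_mul, Complex.norm_real, Real.norm_of_nonneg hr, mul_comm]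
  gcongr
  · exact hP z hz
  · refine le_trans ?_ (Complex.re_le_norm _)
    rw [hr2, Complex.add_re, Complex.ofReal_re, Complex.re_sum]
    gcongr with i hi
    rw [Complex.re_ofReal_mul]
    exact mul_le_mul_of_nonneg_left (re_inv_sq_sub_sq_ge hρ hz (hx i hi)).2 (hm i hi)

/-- Partial fractions of `Q / P` when `P` has simple real zeros and `Q / P` is even. -/
theorem aeval_eq_mul_partial_fractions {P Q : ℝ[X]} {S : Finset ℝ} (hroots : P.roots = S.val)
    (hcard : S.card = P.natDegree) (hdeg : Q.natDegree ≤ P.natDegree) (hP0 : P ≠ 0)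
    (hPe : ∀ z : ℂ, aeval (-z) P = 0 → aeval z P = 0)
    (hpar : ∀ z : ℂ, aeval (-z) Q * aeval z P = aeval z Q * aeval (-z) P) :
    ∃ A : ℝ, ∀ z : ℂ, (∀ x ∈ S, z ^ 2 - (x : ℂ) ^ 2 ≠ 0) → aeval z Q = aeval z P *
      (A + ∑ x ∈ S, ((Q.eval x / (derivative P).eval x * x : ℝ) : ℂ) *
        (z ^ 2 - (x : ℂ) ^ 2)⁻¹) := by
  set c := P.leadingCoeff with hc
  have hc0 : c ≠ 0 := leadingCoeff_ne_zero.2 hP0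
  have hPn : P = C c * Lagrange.nodal S id := by
    rw [Lagrange.nodal_eq]
    have := C_leadingCoeff_mul_prod_multiset_X_sub_C (p := P) (by rw [hroots]; exact hcard)
    rw [hroots] at this
    exact this.symm
  -- Removing A·P lowers the degree below the number of nodes, so Lagrange interpolation at the
  -- zeros of P is exact.
  set A := Q.coeff P.natDegree / c with hA
  refine ⟨A, ?_⟩
  have hHdeg : (Q - C A * P).degree < S.card := by
    rw [hcard, degree_lt_iff_coeff_zero]
    intro m hm
    rcases hm.eq_or_lt with rfl | hm
    · rw [coeff_sub, coeff_C_mul, hA, coeff_natDegree, ← hc, div_mul_cancel₀ _ hc0, sub_self]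
    · rw [coeff_sub, coeff_C_mul, coeff_eq_zero_of_natDegree_lt hm,
        coeff_eq_zero_of_natDegree_lt (hdeg.trans_lt hm)]
      simp
  have hinj : Set.InjOn (fun x : ℝ => (x : ℂ)) S := Complex.ofReal_injective.injOn
  have hfrac : ∀ w : ℂ, (∀ x ∈ S, w ≠ x) → aeval w Q = aeval w P *
      (A + ∑ x ∈ S, ((Q.eval x / (derivative P).eval x : ℝ) : ℂ) * (w - x)⁻¹) := by
    intro w hw
    have hnodal : (Lagrange.nodal S id).map (algebraMap ℝ ℂ) =
        Lagrange.nodal S (fun x : ℝ => (x : ℂ)) := by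
      simp [Lagrange.nodal_eq, Polynomial.map_prod]
    have hi := Lagrange.eq_interpolate hinj (f := (Q - C A * P).map (algebraMap ℝ ℂ))
      (by rwa [degree_map])
    have he := congrArg (eval w) hi
    rw [Lagrange.eval_interpolate_not_at_node _ hw] at he
    have hterm : ∀ x ∈ S, Lagrange.nodalWeight S (fun x : ℝ => (x : ℂ)) x * (w - (x : ℂ))⁻¹ *
        eval (x : ℂ) ((Q - C A * P).map (algebraMap ℝ ℂ)) =
        (c : ℂ) * (((Q.eval x / (derivative P).eval x : ℝ) : ℂ) * (w - x)⁻¹) := by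
      intro x hx
      have hPx : P.eval x = 0 := by
        have : x ∈ P.roots := by rw [hroots]; exact hx
        exact (mem_roots'.1 this).2
      have e1 : eval (x : ℂ) ((Q - C A * P).map (algebraMap ℝ ℂ)) = ((Q.eval x : ℝ) : ℂ) := by
        rw [show (x : ℂ) = algebraMap ℝ ℂ x from rfl, eval_map_algebraMap,
          aeval_algebraMap_apply_eq_algebraMap_eval, eval_sub, eval_mul, hPx, mul_zero, sub_zero]
        rfl
      have e2 : Lagrange.nodalWeight S (fun x : ℝ => (x : ℂ)) x =
          (c : ℂ) * (((derivative P).eval x : ℝ) : ℂ)⁻¹ := by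
        rw [Lagrange.nodalWeight_eq_eval_derivative_nodal hx, ← hnodal, derivative_map,
          show (x : ℂ) = algebraMap ℝ ℂ x from rfl, eval_map_algebraMap,
          aeval_algebraMap_apply_eq_algebraMap_eval, hPn, derivative_C_mul, eval_mul, eval_C]
        have : (c : ℂ) ≠ 0 := by exact_mod_cast hc0
        push_cast
        rw [mul_inv, ← mul_assoc, mul_inv_cancel₀ this, one_mul]
        rfl
      rw [e1, e2]
      push_cast
      ring
    rw [Finset.sum_congr rfl hterm, ← Finset.mul_sum, ← mul_assoc, ← hnodal, eval_map_algebraMap,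
      eval_map_algebraMap, map_sub, map_mul, aeval_C] at he
    have hPw : aeval w P = aeval w (Lagrange.nodal S id) * (c : ℂ) := by
      conv_lhs => rw [hPn]
      rw [map_mul, aeval_C, mul_comm]; rfl
    rw [← hPw] at he
    have : (algebraMap ℝ ℂ) A = (A : ℂ) := rfl
    rw [this] at he
    linear_combination he
  intro z hz
  have hz1 : ∀ x ∈ S, z ≠ x := fun x hx h => hz x hx (by rw [h, sub_self])
  have hz2 : ∀ x ∈ S, -z ≠ x := fun x hx h => hz x hx (by rw [← h]; ring)
  have hPz : aeval z P ≠ 0 := by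
    intro h
    rw [hPn, map_mul, Lagrange.nodal_eq, map_prod, aeval_C] at h
    rcases mul_eq_zero.1 h with h | h
    · exact hc0 (Complex.ofReal_eq_zero.1 h)
    · obtain ⟨x, hx, h⟩ := Finset.prod_eq_zero_iff.1 h
      rw [map_sub, aeval_X, aeval_C, sub_eq_zero] at h
      exact hz1 x hx h
  have hPz' : aeval (-z) P ≠ 0 := fun h => hPz (hPe z h)
  have f1 := hfrac z hz1
  have f2 := hfrac (-z) hz2
  have hp := hpar z
  rw [f1, f2] at hp
  set R1 := (A : ℂ) + ∑ x ∈ S, ((Q.eval x / (derivative P).eval x : ℝ) : ℂ) * (z - x)⁻¹ with hR1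
  set R2 := (A : ℂ) + ∑ x ∈ S, ((Q.eval x / (derivative P).eval x : ℝ) : ℂ) * (-z - x)⁻¹ with hR2
  have hRR : R2 = R1 := by
    apply mul_left_cancel₀ (mul_ne_zero hPz hPz')
    linear_combination hp
  rw [f1]
  congr 1
  -- Averaging over z and -z combines 1/(z-x) and 1/(-z-x) into x/(z²-x²).
  have : R1 = (R1 + R2) / 2 := by rw [hRR]; ring
  rw [this, hR1, hR2, add_add_add_comm, ← Finset.sum_add_distrib, add_div, ← two_mul,
    mul_div_cancel_left₀ _ two_ne_zero, Finset.sum_div]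
  congr 1
  refine Finset.sum_congr rfl fun x hx => ?_
  have d1 : z - x ≠ 0 := sub_ne_zero.2 (hz1 x hx)
  have d2 : -z - x ≠ 0 := sub_ne_zero.2 (hz2 x hx)
  have d3 := hz x hx
  push_cast
  field_simp
  ring

/-! ### Assembly over the ranges of λ. -/

theorem exists_pos_aeval_gegen {ρ : ℝ} (hρ : 1 < ρ) {l : ℝ} (hl : 0 < l) (n : ℕ) :
    ∃ g : ℝ, 0 < g ∧ aeval (minorAxisEndpoint ρ) (gegen l n) = Complex.I ^ n * g := by
  rw [minorAxisEndpoint_eq]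
  refine aeval_gegen_I_mul hl ?_ n
  have := inv_lt_one_of_one_lt₀ hρ
  linarith

theorem exists_pos_aeval_T {ρ : ℝ} (hρ : 1 < ρ) {n : ℕ} (hn : Odd n) :
    ∃ g : ℝ, 0 < g ∧ aeval (minorAxisEndpoint ρ) (Chebyshev.T ℝ n) = Complex.I ^ n * g := by
  have hρ0 : 0 < ρ := by linarith
  have hne : Complex.I * (ρ : ℂ) ≠ 0 :=
    mul_ne_zero Complex.I_ne_zero (by exact_mod_cast hρ0.ne')
  have h : minorAxisEndpoint ρ = (Complex.I * ρ + (Complex.I * ρ)⁻¹) / 2 := by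
    rw [mul_inv, Complex.inv_I, minorAxisEndpoint]; ring
  refine ⟨(ρ ^ n - ρ⁻¹ ^ n) / 2, ?_, ?_⟩
  · have : ρ⁻¹ ^ n < ρ ^ n := by
      have h1 := inv_lt_one_of_one_lt₀ hρ
      have h0 : 0 ≤ ρ⁻¹ := by positivity
      exact pow_lt_pow_left₀ (by linarith) h0 hn.pos.ne'
    linarith
  · rw [h, aeval_T_joukowski n hne, mul_inv, Complex.inv_I, mul_pow, mul_pow, hn.neg_pow]
    push_cast
    ring

theorem gegen_minAtMinorAxis_of_nodes {ρ : ℝ} (hρ : rhoTwoStar ≤ ρ) {l : ℝ} (hl : 0 < l) {n : ℕ}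
    {P : ℝ[X]} (hP : MinAtMinorAxis ρ P) {S : Finset ℝ} (hroots : P.roots = S.val)
    (hcard : S.card = n) (hdeg : P.natDegree = n) (hn : 0 < n)
    (hpar : ∀ z : ℂ, aeval (-z) P = (-1) ^ n * aeval z P)
    (hend : ∃ g : ℝ, 0 < g ∧ aeval (minorAxisEndpoint ρ) P = Complex.I ^ n * g)
    (hS : ∀ x ∈ S, |x| ≤ 1)
    (hnodes : ∀ x ∈ S, 0 ≤ (gegen l n).eval x / (derivative P).eval x * x) :
    MinAtMinorAxis ρ (gegen l n) := by
  have hP0 : P ≠ 0 := by rintro rfl; rw [natDegree_zero] at hdeg; omega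
  obtain ⟨A, hA⟩ := aeval_eq_mul_partial_fractions (Q := gegen l n) hroots (by rw [hcard, hdeg])
    (by rw [natDegree_gegen hl, hdeg]) hP0
    (fun z hz => by
      rw [hpar] at hz
      exact (mul_eq_zero.1 hz).resolve_left (by simp))
    (fun z => by rw [hpar, aeval_neg_gegen]; ring)
  obtain ⟨g, hg, hge⟩ := hend
  obtain ⟨g', hg', hge'⟩ := exists_pos_aeval_gegen (one_lt_rhoTwoStar.trans_le hρ) hl n
  refine hP.of_partial_fractions hρ S A _ id hnodes hS hA ⟨g' / g, by positivity, ?_⟩ ?_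
  · rw [hge, hge']
    have : (g : ℂ) ≠ 0 := by exact_mod_cast hg.ne'
    push_cast
    field_simp
  · rw [hge]
    exact mul_ne_zero (pow_ne_zero _ Complex.I_ne_zero) (by exact_mod_cast hg.ne')

theorem gegen_minAtMinorAxis_of_lt_one {ρ : ℝ} (hρ : rhoTwoStar ≤ ρ) {l : ℝ} (hl : 0 < l)
    (hl1 : l ≤ 1) {n : ℕ} (hn : Odd n) : MinAtMinorAxis ρ (gegen l n) := by
  have hρ1 : 1 < ρ := one_lt_rhoTwoStar.trans_le hρ
  have hroot : ∀ x ∈ (Finset.range n).image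
      (fun k : ℕ => Real.cos ((2 * k + 1) * Real.pi / (2 * n))),
      (Chebyshev.T ℝ n).eval x = 0 ∧ |x| < 1 := by
    intro x hx
    have hx' : x ∈ (Chebyshev.T ℝ n).roots := by rw [Chebyshev.roots_T_real]; exact hx
    have h0 : (Chebyshev.T ℝ n).eval x = 0 := (mem_roots'.1 hx').2
    refine ⟨h0, ?_⟩
    by_contra! h
    have := Chebyshev.one_le_abs_eval_T_real n h
    rw [h0] at this
    norm_num at this
  refine gegen_minAtMinorAxis_of_nodes hρ hl (minAtMinorAxis_T (by linarith) hn)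
    (Chebyshev.roots_T_real n) ?_ ?_ hn.pos (aeval_neg_T n) (exists_pos_aeval_T hρ1 hn)
    (fun x hx => (hroot x hx).2.le)
    (fun x hx => gegen_mul_eval_derivative_T_nonneg hl hl1 hn (hroot x hx).1 (hroot x hx).2)
  · rw [Finset.card_image_of_injOn, Finset.card_range]
    exact (Finset.range n).nodup_map_iff_injOn.mp (Chebyshev.roots_T_real_nodup n)
  · rw [Chebyshev.natDegree_T, Int.natAbs_natCast]

theorem gegen_minAtMinorAxis_of_le_two {ρ : ℝ} (hρ : rhoTwoStar ≤ ρ) {l : ℝ} (hl : 1 ≤ l)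
    (hl2 : l ≤ 2) (n : ℕ) : MinAtMinorAxis ρ (gegen l n) := by
  have hρ1 : 1 < ρ := one_lt_rhoTwoStar.trans_le hρ
  rcases Nat.eq_zero_or_pos n with rfl | hn
  · intro z _
    simp [gegen_zero]
  -- At λ = 1 the polynomial is U_n itself; the node argument works with parameter λ-1 and needs it
  -- positive.
  rcases hl.eq_or_lt with rfl | hl
  · rw [gegen_one_eq_U]; exact minAtMinorAxis_U hρ n
  have hroot : ∀ x ∈ (Finset.range n).image
      (fun k : ℕ => Real.cos ((k + 1) * Real.pi / (n + 1))),
      (Chebyshev.U ℝ n).eval x = 0 ∧ |x| < 1 := by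
    intro x hx
    have hx' : x ∈ (Chebyshev.U ℝ n).roots := by rw [Chebyshev.roots_U_real]; exact hx
    have h0 : (Chebyshev.U ℝ n).eval x = 0 := (mem_roots'.1 hx').2
    refine ⟨h0, ?_⟩
    obtain ⟨k, -, rfl⟩ := Finset.mem_image.1 hx
    refine lt_of_le_of_ne (Real.abs_cos_le_one _) fun h => ?_
    have hn1 : (n : ℝ) + 1 ≠ 0 := by positivity
    rcases (abs_eq zero_le_one).1 h with h | h <;> rw [h] at h0
    · rw [Chebyshev.U_eval_one] at h0
      exact hn1 (by exact_mod_cast h0)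
    · rw [Chebyshev.U_eval_neg_one] at h0
      rcases mul_eq_zero.1 h0 with h0 | h0
      · exact (Int.negOnePow (n : ℤ)).ne_zero (by exact_mod_cast h0)
      · exact hn1 (by exact_mod_cast h0)
  refine gegen_minAtMinorAxis_of_nodes hρ (by linarith) (minAtMinorAxis_U hρ n)
    (Chebyshev.roots_U_real n) ?_ (Chebyshev.natDegree_U_natCast ℝ n) hn
    (fun z => by rw [← gegen_one_eq_U, aeval_neg_gegen])
    (by rw [← gegen_one_eq_U]; exact exists_pos_aeval_gegen hρ1 one_pos n)
    (fun x hx => (hroot x hx).2.le)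
    (fun x hx => gegen_mul_eval_derivative_U_nonneg hl hl2 n (hroot x hx).1 (hroot x hx).2)
  rw [Finset.card_image_of_injOn, Finset.card_range]
  exact (Finset.range n).nodup_map_iff_injOn.mp (Chebyshev.roots_U_real_nodup n)

/-- The weights are multiplicity times r²/(2λ), hence nonnegative. Multiplicities are carried along,
so simplicity of the zeros is not required. -/
theorem gegen_minAtMinorAxis_add_one {ρ : ℝ} (hρ : rhoTwoStar ≤ ρ) {l : ℝ} (hl : 0 < l) {n : ℕ}
    (h : MinAtMinorAxis ρ (gegen l n)) : MinAtMinorAxis ρ (gegen (l + 1) n) := by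
  classical
  have hρ1 : 1 < ρ := one_lt_rhoTwoStar.trans_le hρ
  set F := (gegen l n).map (algebraMap ℝ ℂ) with hF
  have hF0 : F ≠ 0 := map_ne_zero (gegen_ne_zero hl n)
  have hmem : ∀ r ∈ F.roots.toFinset, |r.re| ≤ 1 ∧ r = (r.re : ℂ) := by
    intro r hr
    have h0 : aeval r (gegen l n) = 0 := by
      have := (mem_roots'.1 (Multiset.mem_toFinset.1 hr)).2
      rwa [IsRoot.def, eval_map_algebraMap] at this
    obtain ⟨x, hx, rfl⟩ := gegen_roots_mem hl h0
    exact ⟨by simpa using hx, by simp⟩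
  obtain ⟨g, hg, hge⟩ := exists_pos_aeval_gegen hρ1 hl n
  obtain ⟨g', hg', hge'⟩ := exists_pos_aeval_gegen hρ1 (show 0 < l + 1 by linarith) n
  have hl0 : (l : ℂ) ≠ 0 := by exact_mod_cast hl.ne'
  refine h.of_partial_fractions hρ F.roots.toFinset
    ((n + 2 * l + ∑ r ∈ F.roots.toFinset, (F.roots.count r : ℝ)) / (2 * l))
    (fun r => F.roots.count r * r.re ^ 2 / (2 * l)) Complex.re
    (fun r _ => by positivity) (fun r hr => (hmem r hr).1) ?_ ⟨g' / g, by positivity, ?_⟩ ?_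
  · intro z hz
    have hz1 : ∀ r ∈ F.roots.toFinset, z - r ≠ 0 ∧ -z - r ≠ 0 := by
      intro r hr
      have h1 := hz r hr
      rw [← (hmem r hr).2] at h1
      constructor
      · intro h2; exact h1 (by linear_combination (z + r) * h2)
      · intro h2; exact h1 (by linear_combination (r - z) * h2)
    have hev : ∀ w : ℂ, (∀ r ∈ F.roots.toFinset, w - r ≠ 0) → aeval w (gegen l n) ≠ 0 := by
      intro w hw h0
      refine hw w (Multiset.mem_toFinset.2 ((mem_roots hF0).2 ?_)) (sub_self w)
      rwa [IsRoot.def, eval_map_algebraMap]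
    have hlog : ∀ w : ℂ, (∀ r ∈ F.roots.toFinset, w - r ≠ 0) →
        2 * l * aeval w (gegen (l + 1) n) = aeval w (gegen l n) *
          ((n + 2 * l) + ∑ r ∈ F.roots.toFinset, (F.roots.count r : ℂ) * (w / (w - r))) := by
      intro w hw
      have h0 := hev w hw
      have h1 := (IsAlgClosed.splits F).eval_derivative_eq_eval_mul_sum (x := w)
        (by rwa [hF, eval_map_algebraMap])
      rw [Finset.sum_multiset_map_count, hF, derivative_map, eval_map_algebraMap,
        eval_map_algebraMap, ← hF] at h1
      have h2 := congrArg (aeval w) (gegen_add_one l n)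
      simp only [map_mul, map_add, aeval_C, aeval_X, map_ofNat, map_natCast,
        Complex.coe_algebraMap] at h2
      have h3 : ∑ r ∈ F.roots.toFinset, (F.roots.count r : ℂ) * (w / (w - r)) =
          w * ∑ r ∈ F.roots.toFinset, F.roots.count r • (1 / (w - r)) := by
        rw [Finset.mul_sum]
        refine Finset.sum_congr rfl fun r _ => ?_
        rw [nsmul_eq_mul]; ring
      rw [h2, h1, h3]
      ring
    have e1 := hlog z fun r hr => (hz1 r hr).1
    have e2 := hlog (-z) fun r hr => (hz1 r hr).2
    rw [aeval_neg_gegen, aeval_neg_gegen] at e2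
    have hsgn : ((-1 : ℂ) ^ n) ≠ 0 := by simp
    have e3 : 2 * l * aeval z (gegen (l + 1) n) = aeval z (gegen l n) *
          ((n + 2 * l) + ∑ r ∈ F.roots.toFinset, (F.roots.count r : ℂ) * (-z / (-z - r))) := by
      apply mul_left_cancel₀ hsgn
      linear_combination e2
    -- Termwise, z/(z-r) + z/(z+r) = 2 + 2r²/(z²-r²); the constants 2 account for the multiplicity
    -- sum inside A.
    have hsum : (∑ r ∈ F.roots.toFinset, (F.roots.count r : ℂ) * (z / (z - r))) +
        ∑ r ∈ F.roots.toFinset, (F.roots.count r : ℂ) * (-z / (-z - r)) =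
        2 * ∑ r ∈ F.roots.toFinset, (F.roots.count r : ℂ) + 2 * (2 * l) *
        ∑ r ∈ F.roots.toFinset, ((F.roots.count r * r.re ^ 2 / (2 * l) : ℝ) : ℂ) *
          (z ^ 2 - (r.re : ℂ) ^ 2)⁻¹ := by
      rw [Finset.mul_sum, Finset.mul_sum, ← Finset.sum_add_distrib, ← Finset.sum_add_distrib]
      refine Finset.sum_congr rfl fun r hr => ?_
      have d1 := (hz1 r hr).1
      have d2 := (hz1 r hr).2
      have d3 := hz r hr
      push_cast
      rw [← (hmem r hr).2] at d3 ⊢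
      field_simp
      ring
    apply mul_left_cancel₀ (mul_ne_zero (two_ne_zero (α := ℂ)) hl0)
    push_cast at hsum ⊢
    rw [mul_left_comm, mul_add, mul_div_cancel₀ _ (mul_ne_zero (two_ne_zero (α := ℂ)) hl0)]
    linear_combination (e1 + e3) / 2 + aeval z (gegen l n) / 2 * hsum
  · rw [hge, hge']
    have : (g : ℂ) ≠ 0 := by exact_mod_cast hg.ne'
    push_cast
    field_simp
  · rw [hge]
    exact mul_ne_zero (pow_ne_zero _ Complex.I_ne_zero) (by exact_mod_cast hg.ne')

theorem gegen_minAtMinorAxis_of_one_le {ρ : ℝ} (hρ : rhoTwoStar ≤ ρ) (m n : ℕ) :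
    ∀ l : ℝ, 1 ≤ l → l ≤ m + 2 → MinAtMinorAxis ρ (gegen l n) := by
  induction m with
  | zero =>
    intro l h1 h2
    exact gegen_minAtMinorAxis_of_le_two hρ h1 (by simpa using h2) n
  | succ m ih =>
    intro l h1 h2
    rcases le_or_gt l 2 with h | h
    · exact gegen_minAtMinorAxis_of_le_two hρ h1 h n
    · have := gegen_minAtMinorAxis_add_one hρ (l := l - 1) (n := n) (by linarith)
        (ih (l - 1) (by linarith) (by push_cast at h2; linarith))
      rwa [sub_add_cancel] at this

theorem isLeast_of_minAtMinorAxis {ρ : ℝ} {l : ℝ} {n : ℕ} (hl : 0 < l)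
    (h : MinAtMinorAxis ρ (gegen l n)) :
    IsLeast ((fun z : ℂ => ‖aeval z (gegenbauerPoly l n)‖) '' bernsteinEllipse ρ)
        ‖aeval (minorAxisEndpoint ρ) (gegenbauerPoly l n)‖ ∧
      IsLeast ((fun z : ℂ => ‖aeval z (gegenbauerPoly l n)‖) '' bernsteinEllipse ρ)
        ‖aeval (-minorAxisEndpoint ρ) (gegenbauerPoly l n)‖ := by
  obtain ⟨κ, hκ⟩ := gegenbauerPoly_eq hl n
  have hneg : ‖aeval (-minorAxisEndpoint ρ) (gegenbauerPoly l n)‖ =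
      ‖aeval (minorAxisEndpoint ρ) (gegenbauerPoly l n)‖ := by
    rw [hκ, map_mul, map_mul, aeval_C, aeval_C, aeval_neg_gegen]
    simp
  have hlow : ‖aeval (minorAxisEndpoint ρ) (gegenbauerPoly l n)‖ ∈ lowerBounds
      ((fun z : ℂ => ‖aeval z (gegenbauerPoly l n)‖) '' bernsteinEllipse ρ) := by
    rintro _ ⟨z, hz, rfl⟩
    simp only [hκ, map_mul, norm_mul, aeval_C]
    exact mul_le_mul_of_nonneg_left (h z hz) (norm_nonneg _)
  refine ⟨⟨⟨_, minorAxisEndpoint_mem ρ, rfl⟩, hlow⟩, ⟨_, neg_minorAxisEndpoint_mem ρ, rfl⟩, ?_⟩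
  rw [hneg]
  exact hlow

/-- The first two conjuncts say that `rhoTwoStar` is the unique root in `(1, ∞)` of
`a_3(ρ) - 3 a_1(ρ) = 0`; the last one is the statement about the minimum. -/
theorem theorem4p7 :
    1 < rhoTwoStar ∧
    (∀ ρ : ℝ, 1 < ρ → (ellipseA 3 ρ - 3 * ellipseA 1 ρ = 0 ↔ ρ = rhoTwoStar)) ∧
    (∀ (ρ l : ℝ) (n : ℕ), rhoTwoStar ≤ ρ → 2 ≤ n →
      (1 < l ∨ (0 < l ∧ l < 1 ∧ Odd n)) →
      IsLeast ((fun z : ℂ => ‖aeval z (gegenbauerPoly l n)‖) '' bernsteinEllipse ρ)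
          ‖aeval (minorAxisEndpoint ρ) (gegenbauerPoly l n)‖ ∧
      IsLeast ((fun z : ℂ => ‖aeval z (gegenbauerPoly l n)‖) '' bernsteinEllipse ρ)
          ‖aeval (-minorAxisEndpoint ρ) (gegenbauerPoly l n)‖) := by
  refine ⟨one_lt_rhoTwoStar, fun ρ hρ => ellipseA_three_sub_eq_zero_iff hρ, ?_⟩
  rintro ρ l n hρ - (hl | ⟨hl, hl1, hn⟩)
  · refine isLeast_of_minAtMinorAxis (by linarith)
      (gegen_minAtMinorAxis_of_one_le hρ ⌈l⌉₊ n l hl.le ?_)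
    linarith [Nat.le_ceil l]
  · exact isLeast_of_minAtMinorAxis hl (gegen_minAtMinorAxis_of_lt_one hρ hl hl1.le hn)
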